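/- **Model.** Registers are quantum or classical and finite-dimensional; protocol, simulator and adversary registers start at $0$, and the application's private registers start at arbitrary basis values. A gate is a classically controlled operation: a unitary on quantum registers, a permutation of the values of classical registers, or a measurement of a quantum register whose outcome is added to a classical register. A *circuit* is a finite set of gates with a strict partial order, which may depend on the initial values of the registers, in which any two gates that access a common register are ordered. It is executed in any order compatible with the partial order. A *protocol* $P$ is a finite set of module-role-circuits $r$ with private registers, internal channel registers, input/output channel registers and activation registers (a communication gate is executed only if its activation register has been set, and every gate that sets this register precedes it). Each channel register has a channel-type, which says whether it may be read, or read and modified, in the name of $r$ and in nobody's name. A circuit $r$ is not corruptible, or has a corruption bit $C_r$ that switches its gates off, or is a passive auxiliary circuit that is corrupted all the time. An *environment* $E=App+Adv$ for $P$ is a circuit together with a partial order on the gates of $E+P$ that makes $E+P$ a circuit. The application $App$ holds the output bit $Z$ among private registers of its own, may change the corruption bits, may use the input/output channels, and may also interact directly with the internal channel registers of $P$ in accordance with their channel-types. The adversary $Adv$ consists of circuits $A(r)$ that are active only when $r$ is corrupted; they do not access the application's private registers, and use the registers of $r$ and the channel registers in accordance with their channel-types, possibly in the name of $r$. An *ideal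 protocol* $I(P)$ is a protocol containing circuits $I(r)$ for some of the circuits $r$ of $P$, with the same corruption status and input/output channels as $r$, plus non-corruptible circuits; its other registers are its own. On the ideal side the private and internal channel registers of $P$ are free. A *simulator* $S$ and an *ideal adversary* $Adv'$ may use these freely and may read corruption bits; they use the input/output channels of a circuit $r$, and the registers of $I(P)$ through a circuit $I(r)$, only while $r$ is corrupted and in accordance with the channel-types. A simulator accesses no register of the environment (that is not a register of $P$); an ideal adversary accesses no private register of the application. The partial orders on $App+Adv+S+I(P)$ and $App+Adv'+I(P)$ extend those of $I(P)$ and of $E$, respectively of $App$, and make these settings circuits. The size of a circuit is its number of gates. **Definitions.** Let $\varepsilon$ be a real function of the environment, and fix a class of valid environments. * (Original) $P$ *$\varepsilon$-securely realizes* $I(P)$ if for every $E=App+Adv$ in the class there is a valid simulator $S$ such that, for all initial values of the application's private registers, $|\Pr(Z_{App+Adv+P}=0)-\Pr(Z_{App+Adv+S+I(P)}=0)|\le\varepsilon(E)$. * (Alternative) The same, but with a valid ideal adversary $Adv'$ and the ideal side $App+Adv'+I(P)$. * (Computational versions) $P=(P_n)$ and $I=(I_n)$ have polynomial size, and there is one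 function $\varepsilon(n,s)$ that is negligible (for every polynomially bounded $f$ and every positive polynomial $q$, $\varepsilon(n,f(n))\le 1/q(n)$ for all large $n$) such that for every polynomial-size family $(E_n)$ of environments in the class there is a polynomial-size family of simulators (respectively ideal adversaries) satisfying the bound with $\varepsilon(n,|E_n|)$ for every $n$. A *dummy* environment is one whose adversary only forwards: each of its gates, controlled by nothing but the corruption bit, exchanges registers of $P$ with registers of the environment, or copies classical values from the former to the latter, or erases such copies. $P$ *has an always active adversary circuit* if one of its circuits is corrupted all the time. **Theorem.** Let $P$ be a protocol and $I(P)$ an ideal protocol for it. "All environments" means all valid ones, including those whose application interacts directly with internal channel registers. 1. There is an absolute constant $\kappa$ such that for all $P$, $I(P)$: for every $\varepsilon$, if $P$ $\varepsilon$-securely realizes $I(P)$ in the original sense against all environments, it does so in the alternative sense; and there is a map $E\mapsto E'$ from valid environments to valid dummy environments, with $|E'|\le\kappa|E|$, such that for every $\varepsilon$, security in the alternative sense against all environments with bound $\varepsilon(E)$ implies security in the original sense against all environments with bound $\varepsilon(E')$, and so does security in the original sense against dummy environments with bound $\varepsilon(E)$. If $P$ has an always active adversary circuit, then the application in $E'$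 does not interact directly with internal channel registers, and the same implication holds from security in the original sense against all environments with this restriction. 2. (Unconditional scenario.) For every constant $\varepsilon$ the following are equivalent: $P$ $\varepsilon$-securely realizes $I(P)$ (a) in the original sense against all environments; (b) in the original sense against all dummy environments; (c) in the alternative sense against all environments. If $P$ has an always active adversary circuit, they are also equivalent to (d): in the original sense against all environments in which the application does not interact directly with internal channel registers. 3. (Computational scenario.) For families $(P_n)$, $(I_n)$ the computational versions of (a), (b), (c) are equivalent, and if every $P_n$ has an always active adversary circuit, also to that of (d). -/

import Mathlib

namespace QUC

/-! ### Registers, gates and their action -/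

/-- A register: a name, a kind (quantum or classical) and its largest basis value `top`
(the dimension, or the number of classical values, is `top + 1`). -/
structure Reg where
  name : ℕ
  quantum : Bool
  top : ℕ
deriving DecidableEq

/-- A (computational basis) value of every register. -/
abbrev Config : Type := (y : Reg) → Fin (y.top + 1)

/-- State vectors: finite superpositions of basis values. -/
abbrev State : Type := Config →₀ ℂ

/-- Values of the registers of a finite set. -/
abbrev Asg (t : Finset Reg) : Type := (y : t) → Fin (y.1.top + 1)

def Config.restrict (c : Config) (t : Finset Reg) : Asg t := fun y => c y.1

def Config.set (c : Config) (t : Finset Reg) (x : Asg t) : Config :=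
  fun y => if h : y ∈ t then x ⟨y, h⟩ else c y

/-- The elementary operations: a unitary on quantum registers, a permutation of the values of
classical registers, and the measurement of a quantum register `q` in the computational basis, whose
outcome is added to a classical register `k` with as many values as `q` (so it is stored in `k` when
`k` is fresh, that is, still zero). -/
inductive Op where
  | unitary (t : Finset Reg) (ht : ∀ y ∈ t, y.quantum = true)
      (U : Matrix.unitaryGroup (Asg t) ℂ)
  | classical (t : Finset Reg) (ht : ∀ y ∈ t, y.quantum = false) (p : Equiv.Perm (Asg t))
  | measure (q k : Reg) (hq : q.quantum = true) (hk : k.quantum = false) (h : q.top = k.top)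

/-- The registers that an operation acts on. -/
def Op.targets : Op → Finset Reg
  | .unitary t _ _ => t
  | .classical t _ _ => t
  | .measure q k _ _ _ => {q, k}

/-- The number of outcomes of an operation (one, unless it is a measurement). -/
def Op.numOut : Op → ℕ
  | .unitary _ _ _ => 1
  | .classical _ _ _ => 1
  | .measure q _ _ _ _ => q.top + 1

/-- The unnormalised state into which the basis state `c` is sent when the outcome is `x`. -/
noncomputable def Op.branch : Op → ℕ → Config → State
  | .unitary t _ U, _, c => ∑ a : Asg t, Finsupp.single (c.set t a) (U.1 a (c.restrict t))
  | .classical t _ p, _, c => Finsupp.single (c.set t (p (c.restrict t))) 1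
  | .measure q k _ _ _, x, c =>
      if (c q : ℕ) = x then
        Finsupp.single (Function.update c k (Fin.ofNat (k.top + 1) ((c k : ℕ) + (c q : ℕ)))) 1
      else 0

/-- A classically controlled gate: the operation `op` is executed exactly when every classical
control register `y` with `(y, b) ∈ guard` has the value `b`. -/
structure Gate where
  guard : Finset (Reg × ℕ)
  op : Op
  guard_classical : ∀ p ∈ guard, p.1.quantum = false
  guard_target : ∀ p ∈ guard, p.1 ∉ op.targets

/-- The registers that a gate accesses: its control registers and its targets. -/
def Gate.regs (g : Gate) : Finset Reg := g.guard.image Prod.fst ∪ g.op.targets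

/-- The controlled part of the gate is active. -/
def Gate.Active (g : Gate) (c : Config) : Prop := ∀ p ∈ g.guard, (c p.1 : ℕ) = p.2

/-- The gate does more to `y` than read a classical value. -/
def Gate.Modifies (g : Gate) (y : Reg) : Prop :=
  y ∈ g.op.targets ∧
    (y.quantum = true ∨ ∃ (c c' : Config) (x : ℕ), g.op.branch x c c' ≠ 0 ∧ c' y ≠ c y)

open Classical in
/-- The Kraus operator of a gate for the outcome `x`; an inactive gate is the identity (with the
single outcome `0`). -/
noncomputable def Gate.kraus (g : Gate) (x : ℕ) : State →ₗ[ℂ] State :=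
  Finsupp.linearCombination ℂ fun c : Config =>
    if g.Active c then g.op.branch x c else if x = 0 then Finsupp.single c 1 else 0

open Classical in
/-- The probability that register `Z` has the value `0` after the gates of a list have been executed,
one after the other, on the state `s`: the sum over all sequences of measurement outcomes. -/
noncomputable def probZero (Z : Reg) : List Gate → State → ℝ
  | [], s => s.sum fun c a => if (c Z : ℕ) = 0 then ‖a‖ ^ 2 else 0
  | g :: l, s => ∑ x ∈ Finset.range g.op.numOut, probZero Z l (g.kraus x s)

/-! ### Circuits -/

/-- A finite set of gates with a relation `lt` (`g` precedes `h`) that may depend on the initial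
value `v` of the registers. -/
structure Circuit where
  Idx : Type
  fin : Fintype Idx
  gate : Idx → Gate
  lt : Config → Idx → Idx → Prop

attribute [instance] Circuit.fin

def Circuit.size (C : Circuit) : ℕ := Fintype.card C.Idx

/-- `r` is a strict partial order. -/
def StrictOrder {ι : Type} (r : ι → ι → Prop) : Prop :=
  (∀ i, ¬ r i i) ∧ ∀ i j k, r i j → r j k → r i k

/-- For every initial value the gates are partially ordered, and two gates that access a common
register are ordered. -/
structure Circuit.IsCircuit (C : Circuit) : Prop where
  order : ∀ v, StrictOrder (C.lt v)
  comparable : ∀ v i j, i ≠ j → ¬ Disjoint (C.gate i).regs (C.gate j).regs →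
    C.lt v i j ∨ C.lt v j i

/-- A sequential execution: all gates, each one once, in an order that is compatible with `lt v`. -/
structure Circuit.IsExecution (C : Circuit) (v : Config) (l : List C.Idx) : Prop where
  nodup : l.Nodup
  all : ∀ i, i ∈ l
  compatible : l.Pairwise fun i j => ¬ C.lt v j i

/-- `Pr (Z = 0)` for an execution that starts with the initial value `v`. -/
noncomputable def Circuit.prob (C : Circuit) (Z : Reg) (v : Config) (l : List C.Idx) : ℝ :=
  probZero Z (l.map C.gate) (Finsupp.single v 1)

/-- `|Pr (Z_C = 0) - Pr (Z_D = 0)| ≤ ε` from the initial value `v`. (The probabilities of a circuit do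
not depend on the execution; the bound is asked for all of them.) -/
def Close (C D : Circuit) (Z : Reg) (v : Config) (ε : ℝ) : Prop :=
  ∀ l m, C.IsExecution v l → D.IsExecution v m → |C.prob Z v l - D.prob Z v m| ≤ ε

/-! ### Protocols -/

/-- What a channel-type lets a party do with a channel register: nothing, reading its classical
value, or anything. -/
inductive Access where
  | no
  | read
  | full

def Access.Permits : Access → Gate → Reg → Prop
  | .no, g, y => y ∉ g.regs
  | .read, g, y => ¬ (g.Modifies y) ∧ y.quantum = false
  | .full, _, _ => True

/-- The status of a module-role-circuit: not corruptible, corruptible with corruption register `C`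
(`0`: not corrupted, `1`: corrupted), or corrupted all the time (a passive auxiliary circuit on whose
behalf an eavesdropper acts). -/
inductive Status where
  | honest
  | corruptible (C : Reg)
  | corrupted

/-- The form of the gates of a module-role-circuit: off when the circuit is corrupted. -/
def Status.RoleGate : Status → Gate → Prop
  | .honest, _ => True
  | .corruptible C, g => (C, 0) ∈ g.guard
  | .corrupted, _ => False

/-- The form of the gates of the adversary circuit: on only when the circuit is corrupted. -/
def Status.AdvGate : Status → Gate → Prop
  | .honest, _ => False
  | .corruptible C, g => (C, 1) ∈ g.guard
  | .corrupted, _ => True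

/-- The controls of an adversary gate that has no other control. -/
def Status.advGuard : Status → Finset (Reg × ℕ)
  | .corruptible C => {(C, 1)}
  | _ => ∅

/-- A protocol: module-role-circuits (the gates are labelled by the circuit they belong to) with their
own registers `priv r`, internal channel registers `chan`, and input/output channel registers `io`
(shared with the application); activation registers are channel registers. The channel-types say what
may be done with a channel register in the name of the circuit `r` (`acc r`) and in nobody's name
(`pub`). The activation register of a communication gate is `act`. -/
structure Protocol where
  Role : Type
  roleFin : Fintype Role
  body : Circuit
  role : body.Idx → Role
  status : Role → Status
  priv : Role → Finset Reg
  chan : Finset Reg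
  io : Finset Reg
  acc : Role → Reg → Access
  pub : Reg → Access
  act : body.Idx → Option Reg

namespace Protocol

variable (P : Protocol)

/-- The corruption registers. -/
def corr : Set Reg := {y | ∃ r, P.status r = .corruptible y}

/-- The registers that only the protocol, the adversary and (for channels) the application see:
the private registers and the internal channel registers. -/
def internal : Set Reg := {y | (∃ r, y ∈ P.priv r) ∨ y ∈ P.chan}

def regs : Set Reg := {y | y ∈ P.internal ∨ y ∈ P.io ∨ y ∈ P.corr}

def size : ℕ := P.body.size

structure WellFormed : Prop where
  order : ∀ v, StrictOrder (P.body.lt v)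
  order_local : ∀ v w, (∀ y ∈ P.regs, v y = w y) → P.body.lt v = P.body.lt w
  /-- each module-role-circuit is a circuit; gates of distinct ones need not be ordered -/
  comparable : ∀ v i j, i ≠ j → P.role i = P.role j →
    ¬ Disjoint (P.body.gate i).regs (P.body.gate j).regs → P.body.lt v i j ∨ P.body.lt v j i
  role_gate : ∀ i, (P.status (P.role i)).RoleGate (P.body.gate i)
  access : ∀ i, ∀ y ∈ (P.body.gate i).regs,
    y ∈ P.priv (P.role i) ∨
    ((y ∈ P.chan ∨ y ∈ P.io) ∧ (P.acc (P.role i) y).Permits (P.body.gate i) y) ∨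
    (P.status (P.role i) = .corruptible y ∧ y ∉ (P.body.gate i).op.targets)
  /-- a gate that accesses a channel register has an activation register -/
  act_exists : ∀ i, ∀ y ∈ (P.body.gate i).regs, y ∈ P.chan ∨ y ∈ P.io → ∃ a, P.act i = some a
  /-- and is executed only if it has been woken up (`0`: SLEEP, `1`: WAKE-UP) -/
  act_guard : ∀ i a, P.act i = some a → (a, 1) ∈ (P.body.gate i).guard ∧ (a ∈ P.chan ∨ a ∈ P.io)
  act_inj : ∀ i j a, P.act i = some a → P.act j = some a → i = j
  /-- the activation registers of gates on an authenticated channel are authenticated -/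
  act_auth : ∀ i a, P.act i = some a → ∀ y ∈ (P.body.gate i).regs, y ∈ P.chan ∨ y ∈ P.io →
    P.pub y ≠ .full → P.pub a ≠ .full
  priv_priv : ∀ r s, r ≠ s → Disjoint (P.priv r) (P.priv s)
  priv_chan : ∀ r, Disjoint (P.priv r) P.chan
  priv_io : ∀ r, Disjoint (P.priv r) P.io
  chan_io : Disjoint P.chan P.io
  corr_fresh : ∀ y ∈ P.corr, y ∉ P.internal ∧ y ∉ P.io
  corr_bit : ∀ y ∈ P.corr, y.quantum = false ∧ y.top = 1
  corr_inj : ∀ r s y, P.status r = .corruptible y → P.status s = .corruptible y → r = s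

/-- There is an adversary circuit that is active all the time. -/
def HasEve : Prop := ∃ r, P.status r = .corrupted

end Protocol

/-- An ideal protocol for `P`: a protocol some of whose circuits `i` are the circuits `I(r)` that
correspond to circuits `r` of `P` (`ofRole i = some r`); the others (such as a trusted party) are not
corruptible and do not communicate with the application. -/
structure IdealProtocol (P : Protocol) extends Protocol where
  ofRole : Role → Option P.Role

structure IdealProtocol.WellFormed {P : Protocol} (I : IdealProtocol P) : Prop where
  protocol : I.toProtocol.WellFormed
  inj : ∀ i j r, I.ofRole i = some r → I.ofRole j = some r → i = j
  /-- `I(r)` is corrupted by the corruption register of `r` -/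
  status_some : ∀ i r, I.ofRole i = some r → I.status i = P.status r
  status_none : ∀ i, I.ofRole i = none → I.status i = .honest
  /-- `I(r)` uses the input/output channels of `r` as if it were `r` -/
  io_subset : I.io ⊆ P.io
  io_acc : ∀ i r, I.ofRole i = some r → ∀ y ∈ I.io, I.acc i y = P.acc r y
  io_none : ∀ i, I.ofRole i = none → ∀ y ∈ I.io, I.acc i y = .no
  io_pub : ∀ y ∈ I.io, I.pub y = P.pub y
  /-- and otherwise the ideal protocol has its own registers -/
  internal_fresh : ∀ y ∈ I.internal, y ∉ P.regs

/-- A well-formed pair of a protocol and an ideal protocol for it. -/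
def WellFormedPair (P : Protocol) (I : IdealProtocol P) : Prop := P.WellFormed ∧ I.WellFormed

/-! ### Environments -/

/-- An environment for `P`: an application and an adversary (the gate `a : Adv` belongs to the adversary
circuit `A(role a)`), the partial order `lt` of this circuit, and the partial order `ord` of the overall
setting, which also orders the gates of `P`. The registers `own` are those of the application that it
does not share with the adversary; the output register `Z` is one of them. All other registers that do
not belong to a protocol can be used by the adversary, and to communicate between the application and
the adversary. -/
structure Env (P : Protocol) where
  App : Type
  Adv : Type
  appFin : Fintype App
  advFin : Fintype Adv
  gate : App ⊕ Adv → Gate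
  lt : Config → App ⊕ Adv → App ⊕ Adv → Prop
  role : Adv → P.Role
  ord : Config → (App ⊕ Adv) ⊕ P.body.Idx → (App ⊕ Adv) ⊕ P.body.Idx → Prop
  own : Finset Reg
  Z : Reg

attribute [instance] Env.appFin Env.advFin

/-- Every gate other than `p` itself that sets the activation register of a communication gate `p`
precedes `p`. Here `emb` embeds the gates of `P` in those of the setting `C`. -/
def Activated (P : Protocol) (C : Circuit) (emb : P.body.Idx → C.Idx) : Prop :=
  ∀ v p a, P.act p = some a → ∀ j, j ≠ emb p → (C.gate j).Modifies a → C.lt v j (emb p)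

namespace Env

variable {P : Protocol} (E : Env P)

/-- The environment alone. -/
def circuit : Circuit where
  Idx := E.App ⊕ E.Adv
  fin := inferInstance
  gate := E.gate
  lt := E.lt

/-- The analysed side `App + Adv + P`. -/
def real : Circuit where
  Idx := (E.App ⊕ E.Adv) ⊕ P.body.Idx
  fin := inferInstance
  gate := Sum.elim E.gate P.body.gate
  lt := E.ord

def size : ℕ := E.circuit.size

/-- The registers of the environment that are not registers of `P`. -/
def regs : Set Reg := {y | (y ∈ E.own ∨ ∃ e, y ∈ (E.gate e).regs) ∧ y ∉ P.regs}

/-- The application uses its own registers, those shared with the adversary, the input/output channels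
and the corruption registers of `P`, and the internal channel registers in accordance with their
channel-type, but not the private registers of the circuits of `P`. -/
def AppAccess : Prop :=
  ∀ a : E.App, ∀ y ∈ (E.gate (.inl a)).regs,
    (∀ r, y ∉ P.priv r) ∧ (y ∈ P.chan → (P.pub y).Permits (E.gate (.inl a)) y)

/-- A gate of the adversary circuit `A(r)` is active only when `r` is corrupted; it uses the registers of
the environment, except `own`, those of `r`, and the channel registers in accordance with their
channel-type, where it can act in the name of `r`. It only reads corruption registers. -/
def AdvAccess : Prop :=
  ∀ a : E.Adv, (P.status (E.role a)).AdvGate (E.gate (.inr a)) ∧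
    ∀ y ∈ (E.gate (.inr a)).regs,
      y ∉ E.own ∧
      (∀ r, y ∈ P.priv r → r = E.role a) ∧
      (y ∈ P.chan ∨ y ∈ P.io →
        (P.acc (E.role a) y).Permits (E.gate (.inr a)) y ∨ (P.pub y).Permits (E.gate (.inr a)) y) ∧
      (y ∈ P.corr → y ∉ (E.gate (.inr a)).op.targets)

/-- A valid environment for `P`, whose register names do not clash with those of the ideal protocol. -/
structure Valid (I : IdealProtocol P) : Prop where
  isCircuit : E.circuit.IsCircuit
  isCircuit_real : E.real.IsCircuit
  ord_env : ∀ v e f, E.lt v e f → E.ord v (.inl e) (.inl f)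
  ord_protocol : ∀ v p q, P.body.lt v p q → E.ord v (.inr p) (.inr q)
  activated : Activated P E.real Sum.inr
  app : E.AppAccess
  adv : E.AdvAccess
  own_fresh : ∀ y ∈ E.own, y ∉ P.regs ∧ y ∉ I.internal
  ideal_fresh : ∀ e, ∀ y ∈ (E.gate e).regs, y ∉ I.internal
  Z_own : E.Z ∈ E.own
  Z_bit : E.Z.quantum = false ∧ E.Z.top = 1

/-- Initial values: arbitrary for the application's own registers, zero for all others. -/
def Initial (v : Config) : Prop := ∀ y, y ∉ E.own → v y = 0

/-- The application does not interact directly with the internal channel registers of `P`. -/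
def NoDirectChannel : Prop := ∀ a : E.App, ∀ y ∈ (E.gate (.inl a)).regs, y ∉ P.chan

end Env

/-- An operation that only forwards between registers of `P` and registers of the environment: these
are paired by `m`, and each pair is exchanged, or the classical value of the register of `P` is added
to, or subtracted from, that of the register of the environment (which copies it and erases the copy). -/
def Op.IsForwarding (P : Protocol) (o : Op) : Prop :=
  ∃ m : Reg → Reg,
    Function.Involutive m ∧
    (∀ y, y ∈ o.targets ↔ m y ≠ y) ∧
    (∀ y ∈ o.targets, (m y).quantum = y.quantum ∧ (m y).top = y.top ∧ (m y ∈ P.regs ↔ y ∉ P.regs)) ∧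
    ((∀ c : Config, ∃ c' : Config, o.branch 0 c = Finsupp.single c' 1 ∧
        ∀ y, (c' y : ℕ) = c (m y)) ∨
     ((∀ y ∈ o.targets, y.quantum = false) ∧ ∀ c : Config, ∃ c' : Config, o.branch 0 c = Finsupp.single c' 1 ∧
        ∀ y, (y ∈ o.targets → y ∉ P.regs → (c' y : ℕ) = ((c y : ℕ) + c (m y)) % (y.top + 1)) ∧
          (y ∉ o.targets ∨ y ∈ P.regs → c' y = c y)) ∨
     ((∀ y ∈ o.targets, y.quantum = false) ∧ ∀ c : Config, ∃ c' : Config, o.branch 0 c = Finsupp.single c' 1 ∧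
        ∀ y, (y ∈ o.targets → y ∉ P.regs → (c y : ℕ) = ((c' y : ℕ) + c (m y)) % (y.top + 1)) ∧
          (y ∉ o.targets ∨ y ∈ P.regs → c' y = c y)))

/-- The adversary is a dummy adversary: it only forwards between the application and the protocol. -/
def Env.IsDummy {P : Protocol} (E : Env P) : Prop :=
  ∀ a : E.Adv, (E.gate (.inr a)).guard = (P.status (E.role a)).advGuard ∧
    (E.gate (.inr a)).op.IsForwarding P

/-! ### The ideal side -/

/-- What a gate of a simulator or of an ideal adversary may do to `P` and `I(P)`. It only reads corruption
registers. The private and internal channel registers of `P`, which are not used by `I(P)`, are at its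
disposal. It uses the other registers of `P` and those of `I(P)` only in an adversary circuit of a
corrupted circuit `r`: input/output channels in accordance with their channel-type, and, if there is a
circuit `I(r)`, the registers of `I(r)` and the internal channels of `I(P)` in accordance with their
channel-type. -/
def IdealAccess {P : Protocol} (I : IdealProtocol P) (g : Gate) : Prop :=
  (∀ y ∈ g.op.targets, y ∉ P.corr) ∧
  ((∀ y ∈ g.regs, y ∉ P.io ∧ y ∉ I.internal) ∨
    ∃ r, (P.status r).AdvGate g ∧ ∀ y ∈ g.regs,
      (y ∈ P.io → (P.acc r y).Permits g y ∨ (P.pub y).Permits g y) ∧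
      (y ∈ I.internal → ∃ i, I.ofRole i = some r ∧
        (y ∈ I.priv i ∨ (y ∈ I.chan ∧ ((I.acc i y).Permits g y ∨ (I.pub y).Permits g y)))))

/-- A simulator against `E`, with the partial order of `App + Adv + S(P) + I(P)`. -/
structure Simulator {P : Protocol} (I : IdealProtocol P) (E : Env P) where
  Idx : Type
  fin : Fintype Idx
  gate : Idx → Gate
  ord : Config → ((E.App ⊕ E.Adv) ⊕ Idx) ⊕ I.body.Idx → ((E.App ⊕ E.Adv) ⊕ Idx) ⊕ I.body.Idx → Prop

attribute [instance] Simulator.fin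

namespace Simulator

variable {P : Protocol} {I : IdealProtocol P} {E : Env P} (S : Simulator I E)

/-- The ideal side `App + Adv + S(P) + I(P)`. -/
def ideal : Circuit where
  Idx := ((E.App ⊕ E.Adv) ⊕ S.Idx) ⊕ I.body.Idx
  fin := inferInstance
  gate := Sum.elim (Sum.elim E.gate S.gate) I.body.gate
  lt := S.ord

def size : ℕ := Fintype.card S.Idx

/-- The simulator interacts with the environment only through registers of the protocol. -/
structure Valid : Prop where
  isCircuit : S.ideal.IsCircuit
  ord_env : ∀ v e f, E.lt v e f → S.ord v (.inl (.inl e)) (.inl (.inl f))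
  ord_protocol : ∀ v p q, I.body.lt v p q → S.ord v (.inr p) (.inr q)
  activated : Activated I.toProtocol S.ideal Sum.inr
  access : ∀ s, IdealAccess I (S.gate s)
  env_fresh : ∀ s, ∀ y ∈ (S.gate s).regs, y ∉ E.regs

end Simulator

/-- An ideal adversary for the application of `E`, with the partial order of `App + Adv' + I(P)`. -/
structure IdealAdv {P : Protocol} (I : IdealProtocol P) (E : Env P) where
  Idx : Type
  fin : Fintype Idx
  gate : Idx → Gate
  ord : Config → (E.App ⊕ Idx) ⊕ I.body.Idx → (E.App ⊕ Idx) ⊕ I.body.Idx → Prop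

attribute [instance] IdealAdv.fin

namespace IdealAdv

variable {P : Protocol} {I : IdealProtocol P} {E : Env P} (A : IdealAdv I E)

/-- The ideal side `App + Adv' + I(P)` of the alternative definition. -/
def ideal : Circuit where
  Idx := (E.App ⊕ A.Idx) ⊕ I.body.Idx
  fin := inferInstance
  gate := Sum.elim (Sum.elim (fun a => E.gate (.inl a)) A.gate) I.body.gate
  lt := A.ord

def size : ℕ := Fintype.card A.Idx

structure Valid : Prop where
  isCircuit : A.ideal.IsCircuit
  ord_app : ∀ v a b, E.lt v (.inl a) (.inl b) → A.ord v (.inl (.inl a)) (.inl (.inl b))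
  ord_protocol : ∀ v p q, I.body.lt v p q → A.ord v (.inr p) (.inr q)
  activated : Activated I.toProtocol A.ideal Sum.inr
  access : ∀ s, IdealAccess I (A.gate s)
  own_fresh : ∀ s, ∀ y ∈ (A.gate s).regs, y ∉ E.own

end IdealAdv

/-! ### The security definitions -/

/-- Classes of environments: all, those with a dummy adversary, and those whose application does not
interact directly with channel registers. -/
def allEnv {P : Protocol} (_ : Env P) : Prop := True

def dummyEnv {P : Protocol} (E : Env P) : Prop := E.IsDummy

def noChannelEnv {P : Protocol} (E : Env P) : Prop := E.NoDirectChannel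

/-- `P` `ε`-securely realizes `I(P)` against the environments of a class: for every environment there is
a simulator such that the analysed side and the ideal side, with the same environment, are `ε`-close. -/
def Realizes {P : Protocol} (I : IdealProtocol P) (K : Env P → Prop) (ε : Env P → ℝ) : Prop :=
  ∀ E : Env P, E.Valid I → K E →
    ∃ S : Simulator I E, S.Valid ∧ ∀ v, E.Initial v → Close E.real S.ideal E.Z v (ε E)

/-- The alternative definition: for every application and adversary there is an ideal adversary such
that the analysed side and the ideal side, with the same application, are `ε`-close. -/
def AltRealizes {P : Protocol} (I : IdealProtocol P) (K : Env P → Prop) (ε : Env P → ℝ) : Prop :=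
  ∀ E : Env P, E.Valid I → K E →
    ∃ A : IdealAdv I E, A.Valid ∧ ∀ v, E.Initial v → Close E.real A.ideal E.Z v (ε E)

def PolyBounded (f : ℕ → ℕ) : Prop := ∃ p : Polynomial ℕ, ∀ n, f n ≤ p.eval n

/-- `ε n s` is negligible, where `n` is the security parameter and `s` the size of the environment. -/
def Negligible (ε : ℕ → ℕ → ℝ) : Prop :=
  ∀ f : ℕ → ℕ, PolyBounded f → ∀ q : Polynomial ℕ, (∀ n, 0 < q.eval n) →
    ∀ᶠ n in Filter.atTop, ε n (f n) ≤ 1 / ((q.eval n : ℕ) : ℝ)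

/-- `P n` computationally realizes `I n` (`n` is the security parameter). -/
def CompRealizes {P : ℕ → Protocol} (I : (n : ℕ) → IdealProtocol (P n))
    (K : (n : ℕ) → Env (P n) → Prop) : Prop :=
  PolyBounded (fun n => (P n).size) ∧ PolyBounded (fun n => (I n).size) ∧
  ∃ ε : ℕ → ℕ → ℝ, Negligible ε ∧
    ∀ E : (n : ℕ) → Env (P n), (∀ n, (E n).Valid (I n)) → (∀ n, K n (E n)) →
      PolyBounded (fun n => (E n).size) →
      ∃ S : (n : ℕ) → Simulator (I n) (E n), (∀ n, (S n).Valid) ∧ PolyBounded (fun n => (S n).size) ∧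
        ∀ n v, (E n).Initial v → Close (E n).real (S n).ideal (E n).Z v (ε n (E n).size)

/-- The alternative definition in the computational scenario. -/
def AltCompRealizes {P : ℕ → Protocol} (I : (n : ℕ) → IdealProtocol (P n))
    (K : (n : ℕ) → Env (P n) → Prop) : Prop :=
  PolyBounded (fun n => (P n).size) ∧ PolyBounded (fun n => (I n).size) ∧
  ∃ ε : ℕ → ℕ → ℝ, Negligible ε ∧
    ∀ E : (n : ℕ) → Env (P n), (∀ n, (E n).Valid (I n)) → (∀ n, K n (E n)) →
      PolyBounded (fun n => (E n).size) →
      ∃ A : (n : ℕ) → IdealAdv (I n) (E n), (∀ n, (A n).Valid) ∧ PolyBounded (fun n => (A n).size) ∧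
        ∀ n v, (E n).Initial v → Close (E n).real (A n).ideal (E n).Z v (ε n (E n).size)

end QUC

/-!
A simulator and the adversary together form an ideal adversary, so security in the original sense
implies security in the alternative sense. For the converse, an environment is reduced to one with
a dummy adversary: the gates of the adversary are handed to the application, where they act on
fresh copies of the registers of the protocol. The dummy adversary only moves the contents of these
registers to their copies before the gate and back after it, so that the real side behaves as
before. If some circuit is corrupted all the time, then the dummy adversary serves in its name the
gates of the original application in the same way, which removes their direct use of channels.

An ideal adversary against the reduced environment has to provide the protocol registers itself,
but finds the gates of the environment acting on the copies. In the original ideal setting these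
gates act on the protocol registers, which the simulator may use freely there. It therefore runs
the ideal adversary, and exchanges the protocol registers with the copies before and after each
gate of the environment.

Two details complicate the real side. A register may be moved only in accordance with its
channel-type, hence a classical register that the gate does not modify is copied to its (empty)
copy and later erased there, rather than exchanged. And the exchange must depend on nothing but the
corruption bit in whose name it is done, whereas the gate itself may have further controls; this is
harmless because an exchange that is followed by its inverse has no effect.
-/

namespace QUC

/-! ### Renaming registers -/

/-- The values of a configuration as a non-dependent function, along whose argument one can
rewrite. -/
def Config.val (c : Config) (y : Reg) : ℕ := c y

theorem Config.ext_val {c d : Config} (h : ∀ y, c.val y = d.val y) : c = d :=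
  funext fun y => Fin.ext (h y)

theorem Asg.val_congr {t : Finset Reg} (x : Asg t) {y z : Reg} (hy : y ∈ t) (hz : z ∈ t)
    (h : y = z) : (x ⟨y, hy⟩ : ℕ) = x ⟨z, hz⟩ := by
  subst h; rfl

/-- An involution of the registers that preserves their kind and dimension. -/
structure Renaming where
  toFun : Reg → Reg
  invol : ∀ y, toFun (toFun y) = y
  quantum : ∀ y, (toFun y).quantum = y.quantum
  top : ∀ y, (toFun y).top = y.top

instance : CoeFun Renaming fun _ => Reg → Reg := ⟨Renaming.toFun⟩

namespace Renaming

variable (ρ : Renaming)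

/-- The action of a renaming on basis values. -/
def act (c : Config) : Config := fun y => Fin.cast (by rw [ρ.top]) (c (ρ y))

@[simp] theorem val_act (c : Config) (y : Reg) : (ρ.act c).val y = c.val (ρ y) := rfl

@[simp] theorem act_act (c : Config) : ρ.act (ρ.act c) = c :=
  Config.ext_val fun y => congrArg c.val (ρ.invol y)

theorem act_surjective : Function.Surjective ρ.act := fun c => ⟨_, ρ.act_act c⟩

theorem act_injective : Function.Injective ρ.act := Function.LeftInverse.injective ρ.act_act

theorem mem_image {t : Finset Reg} {y : Reg} : y ∈ t.image ρ ↔ ρ y ∈ t := by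
  refine ⟨fun h => ?_, fun h => Finset.mem_image.2 ⟨_, h, ρ.invol y⟩⟩
  obtain ⟨z, hz, rfl⟩ := Finset.mem_image.1 h
  rwa [ρ.invol]

/-- Renaming the registers of a partial assignment. -/
def asg (t : Finset Reg) : Asg (t.image ρ) ≃ Asg t where
  toFun x y := Fin.cast (by rw [ρ.top]) (x ⟨ρ y.1, Finset.mem_image_of_mem _ y.2⟩)
  invFun x y := Fin.cast (by rw [ρ.top]) (x ⟨ρ y.1, ρ.mem_image.1 y.2⟩)
  left_inv x := funext fun y => Fin.ext (x.val_congr _ y.2 (ρ.invol y.1))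
  right_inv x := funext fun y => Fin.ext (x.val_congr _ y.2 (ρ.invol y.1))

theorem asg_restrict_act (t : Finset Reg) (c : Config) :
    ρ.asg t ((ρ.act c).restrict (t.image ρ)) = c.restrict t :=
  funext fun y => Fin.ext (show c.val (ρ (ρ y.1)) = c.val y.1 by rw [ρ.invol])

theorem act_set_asg (t : Finset Reg) (c : Config) (x : Asg (t.image ρ)) :
    ρ.act (c.set t (ρ.asg t x)) = (ρ.act c).set (t.image ρ) x := by
  refine Config.ext_val fun y => (ρ.val_act _ y).trans ?_
  by_cases h : ρ y ∈ t
  · have h' : y ∈ t.image ρ := ρ.mem_image.2 h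
    simp only [Config.val, Config.set, dif_pos h, dif_pos h']
    exact x.val_congr _ h' (ρ.invol y)
  · have h' : y ∉ t.image ρ := mt ρ.mem_image.1 h
    simp only [Config.val, Config.set, dif_neg h, dif_neg h']
    rfl

end Renaming

theorem submatrix_mem_unitaryGroup {m n : Type*} [Fintype m] [DecidableEq m] [Fintype n]
    [DecidableEq n] {U : Matrix n n ℂ} (hU : U ∈ Matrix.unitaryGroup n ℂ) (e f : m ≃ n) :
    U.submatrix e f ∈ Matrix.unitaryGroup m ℂ := by
  rw [Matrix.mem_unitaryGroup_iff, Matrix.star_eq_conjTranspose] at hU ⊢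
  rw [Matrix.conjTranspose_submatrix, Matrix.submatrix_mul_equiv, hU, Matrix.submatrix_one_equiv]

namespace Op

/-- The same operation on the renamed registers. -/
def rename (ρ : Renaming) : Op → Op
  | .unitary t ht U => .unitary (t.image ρ)
      (fun y hy => by rw [← ρ.quantum]; exact ht _ (ρ.mem_image.1 hy))
      ⟨U.1.submatrix (ρ.asg t) (ρ.asg t), submatrix_mem_unitaryGroup U.2 _ _⟩
  | .classical t ht p => .classical (t.image ρ)
      (fun y hy => by rw [← ρ.quantum]; exact ht _ (ρ.mem_image.1 hy))
      ((ρ.asg t).trans (p.trans (ρ.asg t).symm))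
  | .measure q k hq hk h => .measure (ρ q) (ρ k) (by rw [ρ.quantum, hq]) (by rw [ρ.quantum, hk])
      (by rw [ρ.top, ρ.top, h])

theorem targets_rename (ρ : Renaming) (o : Op) :
    (o.rename ρ).targets = o.targets.image ρ := by
  cases o <;> simp [rename, targets]

theorem numOut_rename (ρ : Renaming) (o : Op) : (o.rename ρ).numOut = o.numOut := by
  cases o <;> simp [rename, numOut, ρ.top]

theorem branch_rename (ρ : Renaming) (o : Op) (x : ℕ) (c : Config) :
    (o.rename ρ).branch x (ρ.act c) = (o.branch x c).mapDomain ρ.act := by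
  cases o with
  | unitary t ht U =>
    simp only [rename, branch, Finsupp.mapDomain_finsetSum, Finsupp.mapDomain_single]
    refine Fintype.sum_equiv (ρ.asg t) _ _ fun a => ?_
    rw [ρ.act_set_asg, Matrix.submatrix_apply, ρ.asg_restrict_act]
  | classical t ht p =>
    simp only [rename, branch, Finsupp.mapDomain_single]
    rw [← (ρ.asg t).apply_symm_apply (p (c.restrict t)), ρ.act_set_asg, Equiv.trans_apply,
      Equiv.trans_apply, ρ.asg_restrict_act]
  | measure q k hq hk h =>
    have hq : (ρ.act c (ρ q) : ℕ) = c q := congrArg c.val (ρ.invol q)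
    have hk : (ρ.act c (ρ k) : ℕ) = c k := congrArg c.val (ρ.invol k)
    simp only [rename, branch, hq, hk, apply_ite (Finsupp.mapDomain ρ.act),
      Finsupp.mapDomain_single, Finsupp.mapDomain_zero]
    congr 2
    refine Config.ext_val fun y => ?_
    rw [Renaming.val_act]
    by_cases hy : y = ρ k
    · rw [hy, ρ.invol]
      simp [Config.val, Fin.ofNat, ρ.top]
    · have hy' : ρ y ≠ k := fun h' => hy (by rw [← h', ρ.invol])
      simp only [Config.val, Function.update_of_ne hy, Function.update_of_ne hy']
      rfl

theorem branch_rename_apply (ρ : Renaming) (o : Op) (x : ℕ) (c c' : Config) :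
    (o.rename ρ).branch x (ρ.act c) (ρ.act c') = o.branch x c c' := by
  rw [branch_rename, Finsupp.mapDomain_apply ρ.act_injective]

theorem eq_of_branch_ne_zero {o : Op} {x : ℕ} {c c' : Config} (h : o.branch x c c' ≠ 0)
    {y : Reg} (hy : y ∉ o.targets) : c' y = c y := by
  cases o with
  | unitary t ht U =>
    simp only [branch, Finsupp.finsetSum_apply] at h
    obtain ⟨a, -, ha⟩ := Finset.exists_ne_zero_of_sum_ne_zero h
    obtain ⟨rfl, -⟩ := Finsupp.single_apply_ne_zero.1 ha
    exact dif_neg hy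
  | classical t ht p =>
    obtain ⟨rfl, -⟩ := Finsupp.single_apply_ne_zero.1 h
    exact dif_neg hy
  | measure q k hq hk hqk =>
    simp only [branch] at h
    split_ifs at h
    · obtain ⟨rfl, -⟩ := Finsupp.single_apply_ne_zero.1 h
      simp only [targets, Finset.mem_insert, Finset.mem_singleton, not_or] at hy
      rw [Function.update_of_ne hy.2]
    · simp at h

theorem branch_eq_mapDomain (o : Op) (x : ℕ) {c d : Config} (h : ∀ y ∈ o.targets, d y = c y) :
    o.branch x d =
      (o.branch x c).mapDomain fun c' y => if y ∈ o.targets then c' y else d y := by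
  cases o with
  | unitary t ht U =>
    have hr : d.restrict t = c.restrict t := funext fun y => h y.1 y.2
    simp only [branch, Finsupp.mapDomain_finsetSum, Finsupp.mapDomain_single, hr, targets]
    refine Finset.sum_congr rfl fun a _ => ?_
    congr 1
    funext y
    by_cases hy : y ∈ t <;> simp [Config.set, hy]
  | classical t ht p =>
    have hr : d.restrict t = c.restrict t := funext fun y => h y.1 y.2
    simp only [branch, Finsupp.mapDomain_single, hr, targets]
    congr 1
    funext y
    by_cases hy : y ∈ t <;> simp [Config.set, hy]
  | measure q k hq hk hqk =>
    have h1 : d q = c q := h q (by simp [targets])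
    have h2 : d k = c k := h k (by simp [targets])
    simp only [branch, h1, h2, apply_ite (Finsupp.mapDomain _), Finsupp.mapDomain_single,
      Finsupp.mapDomain_zero]
    congr 2
    funext y
    by_cases hy : y = k
    · subst hy
      simp [targets]
    · rw [Function.update_of_ne hy, Function.update_of_ne hy]
      split_ifs with hy'
      · exact h y hy'
      · rfl

end Op

namespace Gate

/-- The same gate on the renamed registers. -/
def rename (ρ : Renaming) (g : Gate) : Gate where
  guard := g.guard.image fun p => (ρ p.1, p.2)
  op := g.op.rename ρ
  guard_classical := Finset.forall_mem_image.2 fun p hp => by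
    rw [ρ.quantum]
    exact g.guard_classical p hp
  guard_target := Finset.forall_mem_image.2 fun p hp => by
    rw [Op.targets_rename, ρ.mem_image, ρ.invol]
    exact g.guard_target p hp

variable {g : Gate}

theorem mem_regs {y : Reg} : y ∈ g.regs ↔ (∃ b, (y, b) ∈ g.guard) ∨ y ∈ g.op.targets := by
  simp [regs]

theorem mem_regs_of_mem_guard {p : Reg × ℕ} (h : p ∈ g.guard) : p.1 ∈ g.regs :=
  mem_regs.2 (.inl ⟨p.2, h⟩)

theorem mem_regs_of_mem_targets {y : Reg} (h : y ∈ g.op.targets) : y ∈ g.regs :=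
  mem_regs.2 (.inr h)

theorem regs_rename (ρ : Renaming) (g : Gate) : (g.rename ρ).regs = g.regs.image ρ := by
  simp only [regs, rename, Op.targets_rename, Finset.image_union, Finset.image_image]
  rfl

theorem mem_regs_rename {ρ : Renaming} {y : Reg} : y ∈ (g.rename ρ).regs ↔ ρ y ∈ g.regs := by
  rw [regs_rename, ρ.mem_image]

theorem active_rename {ρ : Renaming} {c : Config} :
    (g.rename ρ).Active (ρ.act c) ↔ g.Active c := by
  simp only [Active, rename, Finset.forall_mem_image]
  exact forall₂_congr fun p _ => by rw [← Config.val, ρ.val_act, ρ.invol, Config.val]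

theorem modifies_rename {ρ : Renaming} {y : Reg} :
    (g.rename ρ).Modifies y ↔ g.Modifies (ρ y) := by
  have act_ne : ∀ c c' : Config, ρ.act c' y ≠ ρ.act c y ↔ c' (ρ y) ≠ c (ρ y) := fun c c' =>
    (Fin.cast_injective _).ne_iff
  simp only [Modifies, rename, Op.targets_rename, ρ.mem_image, ρ.quantum]
  rw [ρ.act_surjective.exists₂]
  simp only [Op.branch_rename_apply, act_ne]

theorem Modifies.mem_regs {y : Reg} (h : g.Modifies y) : y ∈ g.regs :=
  mem_regs_of_mem_targets h.1

theorem modifies_of_quantum {y : Reg} (hy : y ∈ g.regs) (hq : y.quantum = true) :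
    g.Modifies y := by
  obtain ⟨b, hb⟩ | ht := mem_regs.1 hy
  · exact absurd ((g.guard_classical _ hb).symm.trans hq) (by decide)
  · exact ⟨ht, .inl hq⟩

theorem eq_of_branch_ne_zero {x : ℕ} {c c' : Config} (h : g.op.branch x c c' ≠ 0) {y : Reg}
    (hy : ¬ g.Modifies y) : c' y = c y := by
  by_cases ht : y ∈ g.op.targets
  · by_contra hne
    exact hy ⟨ht, .inr ⟨c, c', x, h, hne⟩⟩
  · exact Op.eq_of_branch_ne_zero h ht

/-! ### The action of gates on states -/

theorem kraus_single_of_active {c : Config} (h : g.Active c) (x : ℕ) :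
    g.kraus x (Finsupp.single c 1) = g.op.branch x c := by
  rw [kraus, Finsupp.linearCombination_single, one_smul, if_pos h]

theorem kraus_single_of_not_active {c : Config} (h : ¬ g.Active c) (x : ℕ) :
    g.kraus x (Finsupp.single c 1) = if x = 0 then Finsupp.single c 1 else 0 := by
  rw [kraus, Finsupp.linearCombination_single, one_smul, if_neg h]

theorem kraus_mapDomain_of_branch {g' : Gate} {D : Config → Config} {x : ℕ}
    (active : ∀ c, g'.Active (D c) ↔ g.Active c)
    (branch : ∀ c, g'.op.branch x (D c) = (g.op.branch x c).mapDomain D) (s : State) :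
    g'.kraus x (s.mapDomain D) = (g.kraus x s).mapDomain D := by
  suffices g'.kraus x ∘ₗ Finsupp.lmapDomain ℂ ℂ D = Finsupp.lmapDomain ℂ ℂ D ∘ₗ g.kraus x from
    LinearMap.congr_fun this s
  refine Finsupp.lhom_ext' fun c => LinearMap.ext_ring ?_
  simp only [LinearMap.comp_apply, Finsupp.lsingle_apply, Finsupp.lmapDomain_apply,
    Finsupp.mapDomain_single]
  by_cases h : g.Active c
  · rw [kraus_single_of_active h, kraus_single_of_active ((active c).2 h), branch]
  · rw [kraus_single_of_not_active h, kraus_single_of_not_active (mt (active c).1 h)]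
    split_ifs <;> simp

theorem kraus_rename_mapDomain (ρ : Renaming) (x : ℕ) (s : State) :
    (g.rename ρ).kraus x (s.mapDomain ρ.act) = (g.kraus x s).mapDomain ρ.act :=
  kraus_mapDomain_of_branch (fun _ => active_rename) (fun c => Op.branch_rename ρ g.op x c) s

theorem kraus_mapDomain {D : Config → Config} (fixes : ∀ c, ∀ y ∈ g.regs, D c y = c y)
    (congr : ∀ c c', (∀ y, ¬ g.Modifies y → c' y = c y) → ∀ y ∉ g.op.targets, D c' y = D c y)
    (x : ℕ) (s : State) :
    g.kraus x (s.mapDomain D) = (g.kraus x s).mapDomain D := by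
  refine kraus_mapDomain_of_branch (fun c => ?_) (fun c => ?_) s
  · exact forall₂_congr fun p hp => by rw [fixes c p.1 (mem_regs_of_mem_guard hp)]
  · rw [Op.branch_eq_mapDomain g.op x fun y hy => fixes c y (mem_regs_of_mem_targets hy)]
    refine Finsupp.mapDomain_congr fun c' hc' => funext fun y => ?_
    have hc' := Finsupp.mem_support_iff.1 hc'
    split_ifs with hy
    · rw [fixes c' y (mem_regs_of_mem_targets hy)]
    · exact (congr c c' (fun z hz => eq_of_branch_ne_zero hc' hz) y hy).symm

theorem exists_of_mem_support_kraus {x : ℕ} {s : State} {c' : Config}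
    (h : c' ∈ (g.kraus x s).support) :
    ∃ c ∈ s.support, ∀ y, ¬ g.Modifies y → c' y = c y := by
  rw [Finsupp.mem_support_iff, kraus, Finsupp.linearCombination_apply, Finsupp.sum,
    Finsupp.finsetSum_apply] at h
  obtain ⟨c, hc, hne⟩ := Finset.exists_ne_zero_of_sum_ne_zero h
  refine ⟨c, hc, fun y hy => ?_⟩
  rw [Finsupp.smul_apply, smul_eq_mul] at hne
  have hne := right_ne_zero_of_mul hne
  split_ifs at hne
  · exact eq_of_branch_ne_zero hne hy
  · rw [(Finsupp.single_apply_ne_zero.1 hne).1]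
  · simp at hne

end Gate

/-! ### Permutations of the values of finitely many registers -/

namespace Config

variable {t u : Finset Reg}

/-- The action of a permutation of the values of the registers in `t` on configurations. -/
def permute (p : Equiv.Perm (Asg t)) (c : Config) : Config := c.set t (p (c.restrict t))

theorem permute_of_mem (p : Equiv.Perm (Asg t)) (c : Config) {y : Reg} (hy : y ∈ t) :
    c.permute p y = p (c.restrict t) ⟨y, hy⟩ :=
  dif_pos hy

theorem permute_of_notMem (p : Equiv.Perm (Asg t)) (c : Config) {y : Reg} (hy : y ∉ t) :
    c.permute p y = c y :=
  dif_neg hy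

theorem restrict_permute (p : Equiv.Perm (Asg t)) (c : Config) :
    (c.permute p).restrict t = p (c.restrict t) :=
  funext fun y => permute_of_mem p c y.2

theorem permute_symm_permute (p : Equiv.Perm (Asg t)) (c : Config) :
    (c.permute p).permute p.symm = c := by
  funext y
  by_cases hy : y ∈ t
  · rw [permute_of_mem _ _ hy, restrict_permute, Equiv.symm_apply_apply]
    rfl
  · rw [permute_of_notMem _ _ hy, permute_of_notMem _ _ hy]

theorem permute_permute_symm (p : Equiv.Perm (Asg t)) (c : Config) :
    (c.permute p.symm).permute p = c :=
  permute_symm_permute p.symm c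

theorem permute_comm (h : Disjoint t u) (p : Equiv.Perm (Asg t)) (q : Equiv.Perm (Asg u))
    (c : Config) : (c.permute p).permute q = (c.permute q).permute p := by
  have restrict_eq {t u : Finset Reg} (h : Disjoint t u) (p : Equiv.Perm (Asg t)) :
      (c.permute p).restrict u = c.restrict u := funext fun y =>
    permute_of_notMem p c (Finset.disjoint_right.1 h y.2)
  funext y
  by_cases ht : y ∈ t
  · have hu := Finset.disjoint_left.1 h ht
    rw [permute_of_notMem _ _ hu, permute_of_mem _ _ ht, permute_of_mem _ _ ht,
      restrict_eq h.symm]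
  · rw [permute_of_notMem p _ ht]
    by_cases hu : y ∈ u
    · rw [permute_of_mem _ _ hu, permute_of_mem _ _ hu, restrict_eq h]
    · rw [permute_of_notMem _ _ hu, permute_of_notMem _ _ hu, permute_of_notMem _ _ ht]

end Config

namespace Op

variable {t : Finset Reg} {b : Bool}

/-- The operation on quantum (`b = true`) or classical registers that permutes the basis values. -/
def ofPerm (b : Bool) (ht : ∀ y ∈ t, y.quantum = b) (p : Equiv.Perm (Asg t)) : Op :=
  match b, ht with
  | true, ht => .unitary t ht
      ⟨(1 : Matrix (Asg t) (Asg t) ℂ).submatrix (Equiv.refl _) p,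
        submatrix_mem_unitaryGroup (one_mem _) _ _⟩
  | false, ht => .classical t ht p

variable (ht : ∀ y ∈ t, y.quantum = b) (p : Equiv.Perm (Asg t))

theorem targets_ofPerm : (ofPerm b ht p).targets = t := by
  cases b <;> rfl

theorem numOut_ofPerm : (ofPerm b ht p).numOut = 1 := by
  cases b <;> rfl

theorem branch_ofPerm (x : ℕ) (c : Config) :
    (ofPerm b ht p).branch x c = Finsupp.single (c.permute p) 1 := by
  cases b with
  | false => rfl
  | true =>
    have entry : ∀ a, ((1 : Matrix (Asg t) (Asg t) ℂ).submatrix (Equiv.refl _) p) a (c.restrict t) =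
        if a = p (c.restrict t) then 1 else 0 := fun _ => Matrix.one_apply
    simp only [ofPerm, branch, entry]
    rw [Finset.sum_eq_single (p (c.restrict t)) (fun a _ ha => by rw [if_neg ha]; simp)
      (by simp), if_pos rfl]
    rfl

end Op

/-! ### Sequences of controlled permutations -/

/-- The condition under which a gate with the controls `G` is active. -/
def Config.Holds (G : Finset (Reg × ℕ)) (c : Config) : Prop := ∀ p ∈ G, (c p.1 : ℕ) = p.2

open Classical in
/-- The action of a permutation `f` of the basis values that is controlled by `G`. -/
noncomputable def Config.whenever (G : Finset (Reg × ℕ)) (f : Config → Config) (c : Config) :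
    Config :=
  if c.Holds G then f c else c

theorem Config.whenever_of_holds {G : Finset (Reg × ℕ)} {f : Config → Config} {c : Config}
    (h : c.Holds G) : c.whenever G f = f c :=
  if_pos h

theorem Config.whenever_of_not_holds {G : Finset (Reg × ℕ)} {f : Config → Config} {c : Config}
    (h : ¬ c.Holds G) : c.whenever G f = c :=
  if_neg h

namespace Gate

open Classical in
/-- The operation `o` with the controls `G`. Inadmissible controls are dropped, which makes this a
total function. -/
noncomputable def guarded (G : Finset (Reg × ℕ)) (o : Op) : Gate where
  guard := G.filter fun p => p.1.quantum = false ∧ p.1 ∉ o.targets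
  op := o
  guard_classical _ hp := (Finset.mem_filter.1 hp).2.1
  guard_target _ hp := (Finset.mem_filter.1 hp).2.2

theorem guard_guarded {G : Finset (Reg × ℕ)} {o : Op}
    (h : ∀ p ∈ G, p.1.quantum = false ∧ p.1 ∉ o.targets) : (guarded G o).guard = G :=
  Finset.filter_true_of_mem h

theorem kraus_guarded_ofPerm {G : Finset (Reg × ℕ)} {t : Finset Reg} {b : Bool}
    (ht : ∀ y ∈ t, y.quantum = b) (p : Equiv.Perm (Asg t))
    (hG : ∀ q ∈ G, q.1.quantum = false ∧ q.1 ∉ t) (s : State) :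
    (guarded G (Op.ofPerm b ht p)).kraus 0 s =
      s.mapDomain (Config.whenever G (Config.permute p)) := by
  have active_iff : ∀ c, (guarded G (Op.ofPerm b ht p)).Active c ↔ c.Holds G := fun c => by
    rw [Active, guard_guarded (by rwa [Op.targets_ofPerm]), Config.Holds]
  suffices (guarded G (Op.ofPerm b ht p)).kraus 0 = Finsupp.lmapDomain ℂ ℂ _ from
    LinearMap.congr_fun this s
  refine Finsupp.lhom_ext' fun c => LinearMap.ext_ring ?_
  simp only [LinearMap.comp_apply, Finsupp.lsingle_apply, Finsupp.lmapDomain_apply,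
    Finsupp.mapDomain_single, Config.whenever]
  split_ifs with h
  · rw [kraus_single_of_active ((active_iff c).2 h)]
    exact Op.branch_ofPerm ht p 0 c
  · rw [kraus_single_of_not_active (mt (active_iff c).1 h), if_pos rfl]

end Gate

/-- The action on states of a list of gates that have a single outcome. -/
noncomputable def run : List Gate → State →ₗ[ℂ] State
  | [] => LinearMap.id
  | g :: l => run l ∘ₗ g.kraus 0

theorem run_guarded_ofPerm {κ : Type*} {G : Finset (Reg × ℕ)} {t : κ → Finset Reg} {b : κ → Bool}
    (ht : ∀ k, ∀ y ∈ t k, y.quantum = b k) (p : ∀ k, Equiv.Perm (Asg (t k)))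
    (hG : ∀ q ∈ G, q.1.quantum = false ∧ ∀ k, q.1 ∉ t k) (l : List κ) (s : State) :
    run (l.map fun k => Gate.guarded G (Op.ofPerm (b k) (ht k) (p k))) s =
      s.mapDomain (Config.whenever G fun c => l.foldl (fun c k => c.permute (p k)) c) := by
  induction l generalizing s with
  | nil =>
    have : Config.whenever G (fun c => c) = id := funext fun c => ite_self c
    simp [run, this]
  | cons k l ih =>
    simp only [List.map_cons, run, LinearMap.comp_apply, List.foldl_cons]
    rw [Gate.kraus_guarded_ofPerm (ht k) (p k) (fun q hq => ⟨(hG q hq).1, (hG q hq).2 k⟩), ih,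
      ← Finsupp.mapDomain_comp]
    congr 1
    funext c
    have holds_iff : (c.permute (p k)).Holds G ↔ c.Holds G := forall₂_congr fun q hq => by
      rw [Config.permute_of_notMem _ _ ((hG q hq).2 k)]
    by_cases h : c.Holds G
    · rw [Function.comp_apply, Config.whenever_of_holds h, Config.whenever_of_holds h,
        Config.whenever_of_holds (holds_iff.2 h)]
    · rw [Function.comp_apply, Config.whenever_of_not_holds h, Config.whenever_of_not_holds h,
        Config.whenever_of_not_holds h]

section probZero

variable {Z : Reg}

theorem probZero_append {l : List Gate} (hl : ∀ g ∈ l, g.op.numOut = 1) (m : List Gate)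
    (s : State) : probZero Z (l ++ m) s = probZero Z m (run l s) := by
  induction l generalizing s with
  | nil => rfl
  | cons g l ih =>
    rw [List.forall_mem_cons] at hl
    rw [List.cons_append, probZero, hl.1, Finset.sum_range_one, ih hl.2]
    rfl

theorem probZero_sandwich {pre post m : List Gate} {g g' : Gate} {s : State}
    (hpre : ∀ h ∈ pre, h.op.numOut = 1) (hpost : ∀ h ∈ post, h.op.numOut = 1)
    (hnumOut : g'.op.numOut = g.op.numOut)
    (hkraus : ∀ x, run post (g'.kraus x (run pre s)) = g.kraus x s) :
    probZero Z (pre ++ g' :: post ++ m) s = probZero Z (g :: m) s := by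
  rw [List.append_assoc, probZero_append hpre, List.cons_append, probZero, probZero, hnumOut]
  exact Finset.sum_congr rfl fun x _ => by rw [probZero_append hpost, hkraus]

theorem probZero_flatMap {ι : Type*} {gate : ι → Gate} {block : ι → List Gate}
    {V : Submodule ℂ State} (invariant : ∀ i x, ∀ s ∈ V, (gate i).kraus x s ∈ V)
    (replace : ∀ i m, ∀ s ∈ V, probZero Z (block i ++ m) s = probZero Z (gate i :: m) s)
    (l : List ι) {s : State} (hs : s ∈ V) :
    probZero Z (l.flatMap block) s = probZero Z (l.map gate) s := by
  induction l generalizing s with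
  | nil => rfl
  | cons i l ih =>
    rw [List.flatMap_cons, replace i _ s hs, List.map_cons, probZero, probZero]
    exact Finset.sum_congr rfl fun x _ => ih (invariant i x s hs)

end probZero

/-! ### Exchanging and copying registers -/

/-- Registers `dom`, together with copies. The names of the copies are at least `bound` and, for
different `key`s, different. -/
structure Slot where
  bound : ℕ
  key : ℕ
  dom : Finset Reg
  small : ∀ y ∈ dom, y.name < bound

namespace Slot

variable (σ : Slot)

/-- The copy of a register. -/
def copy (y : Reg) : Reg := ⟨σ.bound + Nat.pair σ.key y.name, y.quantum, y.top⟩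

/-- The register of which `y` is the copy, if there is one. -/
def source (y : Reg) : Reg := ⟨(Nat.unpair (y.name - σ.bound)).2, y.quantum, y.top⟩

/-- The copies of the registers of the slot. -/
def copies : Finset Reg := σ.dom.image σ.copy

/-- The registers of the slot and their copies. -/
def supp : Finset Reg := σ.dom ∪ σ.copies

/-- The register itself, or, for one of the copies, the register of which it is the copy. -/
def original (y : Reg) : Reg := if y ∈ σ.copies then σ.source y else y

variable {σ} {y : Reg}

theorem source_copy : σ.source (σ.copy y) = y := by
  simp [source, copy]

theorem bound_le_name_copy : σ.bound ≤ (σ.copy y).name := Nat.le_add_right _ _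

theorem copy_mem_copies : σ.copy y ∈ σ.copies ↔ y ∈ σ.dom := by
  refine ⟨fun h => ?_, Finset.mem_image_of_mem _⟩
  obtain ⟨z, hz, e⟩ := Finset.mem_image.1 h
  rwa [← source_copy (σ := σ) (y := y), ← e, source_copy]

theorem notMem_dom_of_le (h : σ.bound ≤ y.name) : y ∉ σ.dom := fun hy =>
  (σ.small y hy).not_ge h

theorem notMem_copies_of_lt (h : y.name < σ.bound) : y ∉ σ.copies := fun hy => by
  obtain ⟨z, -, rfl⟩ := Finset.mem_image.1 hy
  exact bound_le_name_copy.not_gt h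

theorem notMem_copies_of_mem_dom (h : y ∈ σ.dom) : y ∉ σ.copies :=
  notMem_copies_of_lt (σ.small y h)

theorem mem_supp : y ∈ σ.supp ↔ y ∈ σ.dom ∨ y ∈ σ.copies := Finset.mem_union

theorem mem_supp_iff_of_lt (h : y.name < σ.bound) : y ∈ σ.supp ↔ y ∈ σ.dom := by
  rw [mem_supp, or_iff_left (notMem_copies_of_lt h)]

theorem original_of_notMem (h : y ∉ σ.copies) : σ.original y = y := if_neg h

theorem original_copy (h : y ∈ σ.dom) : σ.original (σ.copy y) = y := by
  rw [original, if_pos (copy_mem_copies.2 h), source_copy]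

variable (σ) in
/-- The exchange of the registers of the slot with their copies. -/
def ren : Renaming where
  toFun y := if y ∈ σ.dom then σ.copy y else σ.original y
  invol y := by
    by_cases h : y ∈ σ.dom
    · rw [if_pos h, if_neg (notMem_dom_of_le bound_le_name_copy), original_copy h]
    · by_cases h' : y ∈ σ.copies
      · obtain ⟨z, hz, rfl⟩ := Finset.mem_image.1 h'
        rw [if_neg h, original_copy hz, if_pos hz]
      · rw [if_neg h, original_of_notMem h', if_neg h, original_of_notMem h']
  quantum y := by
    unfold original
    split_ifs <;> rfl
  top y := by
    unfold original
    split_ifs <;> rfl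

theorem ren_of_mem_dom (h : y ∈ σ.dom) : σ.ren y = σ.copy y := if_pos h

theorem ren_of_notMem_dom (h : y ∉ σ.dom) : σ.ren y = σ.original y := if_neg h

theorem ren_copy (h : y ∈ σ.dom) : σ.ren (σ.copy y) = y :=
  (ren_of_notMem_dom (notMem_dom_of_le bound_le_name_copy)).trans (original_copy h)

theorem ren_of_notMem_supp (h : y ∉ σ.supp) : σ.ren y = y := by
  rw [mem_supp, not_or] at h
  rw [ren_of_notMem_dom h.1, original_of_notMem h.2]

theorem ren_mem_copies : σ.ren y ∈ σ.copies ↔ y ∈ σ.dom := by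
  by_cases h : y ∈ σ.dom
  · exact iff_of_true (by rwa [ren_of_mem_dom h, copy_mem_copies]) h
  · refine iff_of_false (fun h' => h ?_) h
    obtain ⟨z, hz, e⟩ := Finset.mem_image.1 h'
    rwa [← σ.ren.invol y, ← e, ren_copy hz]

theorem ren_mem_dom : σ.ren y ∈ σ.dom ↔ y ∈ σ.copies := by
  rw [← ren_mem_copies, σ.ren.invol]

theorem ren_mem_supp : σ.ren y ∈ σ.supp ↔ y ∈ σ.supp := by
  rw [mem_supp, mem_supp, ren_mem_dom, ren_mem_copies, or_comm]

theorem mem_supp_iff_ren_ne : y ∈ σ.supp ↔ σ.ren y ≠ y := by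
  refine ⟨fun h e => ?_, not_imp_comm.1 ren_of_notMem_supp⟩
  obtain h | h := mem_supp.1 h
  · exact notMem_copies_of_mem_dom h (e ▸ ren_mem_copies.2 h)
  · exact notMem_copies_of_mem_dom (e ▸ ren_mem_dom.2 h) h

theorem quantum_original : (σ.original y).quantum = y.quantum := by
  unfold original
  split_ifs <;> rfl

/-! ### Parts of a slot -/

section part

variable {κ : Type*} [DecidableEq κ] (f : Reg → κ)

variable (σ) in
/-- The part of a slot that consists of the registers of kind `k`. -/
def part (k : κ) : Slot where
  bound := σ.bound
  key := σ.key
  dom := σ.dom.filter fun y => f y = k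
  small y hy := σ.small y (Finset.mem_filter.1 hy).1

theorem copies_part_subset (k : κ) : (σ.part f k).copies ⊆ σ.copies :=
  Finset.image_subset_image (Finset.filter_subset _ _)

theorem mem_supp_part {k : κ} : y ∈ (σ.part f k).supp ↔ y ∈ σ.supp ∧ f (σ.original y) = k := by
  have mem_dom {z : Reg} : z ∈ (σ.part f k).dom ↔ z ∈ σ.dom ∧ f z = k := Finset.mem_filter
  rw [mem_supp, mem_supp, mem_dom]
  by_cases h : y ∈ σ.copies
  · obtain ⟨z, hz, rfl⟩ := Finset.mem_image.1 h
    have hd : σ.copy z ∉ σ.dom := notMem_dom_of_le bound_le_name_copy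
    rw [show σ.copy z = (σ.part f k).copy z from rfl, copy_mem_copies, mem_dom]
    simp only [hz, true_and]
    rw [show (σ.part f k).copy z = σ.copy z from rfl, original_copy hz]
    simp only [hd, h, false_and, false_or, or_true, true_and]
  · rw [or_iff_left h, or_iff_left fun h' => h (copies_part_subset f k h'), original_of_notMem h]

theorem disjoint_supp_part {i j : κ} (h : i ≠ j) :
    Disjoint (σ.part f i).supp (σ.part f j).supp :=
  Finset.disjoint_left.2 fun _ hi hj =>
    h (((mem_supp_part f).1 hi).2.symm.trans ((mem_supp_part f).1 hj).2)

theorem ren_part (k : κ) (y : Reg) :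
    (σ.part f k).ren y = if f (σ.original y) = k then σ.ren y else y := by
  by_cases hs : y ∈ (σ.part f k).supp
  · obtain ⟨-, hk⟩ := (mem_supp_part f).1 hs
    rw [if_pos hk]
    obtain h | h := mem_supp.1 hs
    · rw [ren_of_mem_dom h, ren_of_mem_dom (Finset.mem_filter.1 h).1]
      rfl
    · obtain ⟨z, hz, rfl⟩ := Finset.mem_image.1 h
      exact (ren_copy hz).trans (ren_copy (Finset.mem_filter.1 hz).1).symm
  · rw [ren_of_notMem_supp hs]
    split_ifs with hk
    · exact (ren_of_notMem_supp fun h => hs ((mem_supp_part f).2 ⟨h, hk⟩)).symm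
    · rfl

theorem original_ren : σ.original (σ.ren y) = σ.original y := by
  by_cases h : y ∈ σ.dom
  · rw [ren_of_mem_dom h, original_copy h, original_of_notMem (notMem_copies_of_mem_dom h)]
  · by_cases h' : y ∈ σ.copies
    · rw [ren_of_notMem_dom h, original_of_notMem
        (notMem_copies_of_mem_dom (ren_of_notMem_dom (σ := σ) h ▸ ren_mem_dom.2 h'))]
    · rw [ren_of_notMem_dom h, original_of_notMem h', original_of_notMem h']

end part

end Slot

namespace Slot

variable {σ : Slot} {y : Reg}

theorem foldl_act_part {κ : Type*} [DecidableEq κ] {f : Reg → κ} {l : List κ} (hl : l.Nodup)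
    (mem : ∀ y, f y ∈ l) (c : Config) :
    l.foldl (fun c k => (σ.part f k).ren.act c) c = σ.ren.act c := by
  suffices ∀ y, (l.foldl (fun c k => (σ.part f k).ren.act c) c).val y =
      c.val (if f (σ.original y) ∈ l then σ.ren y else y) from
    Config.ext_val fun y => (this y).trans (by rw [if_pos (mem _), Renaming.val_act])
  clear mem
  intro y
  induction l generalizing c with
  | nil => simp
  | cons k l ih =>
    obtain ⟨hk, hl⟩ := List.nodup_cons.1 hl
    rw [List.foldl_cons, ih hl, Renaming.val_act, ren_part]
    by_cases h : f (σ.original y) ∈ l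
    · rw [if_pos h, original_ren, if_neg (ne_of_mem_of_not_mem h hk),
        if_pos (List.mem_cons_of_mem _ h)]
    · rw [if_neg h]
      simp only [List.mem_cons, h, or_false]

variable (σ)

/-- The exchange of the registers of a slot with their copies, on values. -/
def swap (x : Asg σ.supp) : Asg σ.supp := fun y =>
  Fin.cast (by rw [σ.ren.top]) (x ⟨σ.ren y, ren_mem_supp.2 y.2⟩)

/-- The exchange of the values of the registers of a slot with those of their copies. -/
def exchange : Equiv.Perm (Asg σ.supp) :=
  Function.Involutive.toPerm σ.swap fun x =>
    funext fun y => Fin.ext (x.val_congr _ y.2 (σ.ren.invol y))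

/-- The values of the registers of a slot are added to those of their copies. -/
def addition : Equiv.Perm (Asg σ.supp) where
  toFun x y := if y.1 ∈ σ.copies then x y + σ.swap x y else x y
  invFun x y := if y.1 ∈ σ.copies then x y - σ.swap x y else x y
  left_inv x := funext fun y => by
    by_cases h : y.1 ∈ σ.copies
    · have hr : σ.ren y ∉ σ.copies := notMem_copies_of_mem_dom (ren_mem_dom.2 h)
      simp only [swap, if_pos h, if_neg hr, add_sub_cancel_right]
    · simp only [if_neg h]
  right_inv x := funext fun y => by
    by_cases h : y.1 ∈ σ.copies
    · have hr : σ.ren y ∉ σ.copies := notMem_copies_of_mem_dom (ren_mem_dom.2 h)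
      simp only [swap, if_pos h, if_neg hr, sub_add_cancel]
    · simp only [if_neg h]

variable {σ}

theorem permute_exchange (c : Config) : c.permute σ.exchange = σ.ren.act c := by
  refine Config.ext_val fun y => ?_
  by_cases h : y ∈ σ.supp
  · rw [Config.val, Config.permute_of_mem _ _ h]
    rfl
  · rw [Config.val, Config.permute_of_notMem _ _ h, Renaming.val_act, ren_of_notMem_supp h,
      Config.val]

theorem val_permute_addition (c : Config) (y : Reg) :
    (c.permute σ.addition).val y =
      if y ∈ σ.copies then (c.val y + c.val (σ.ren y)) % (y.top + 1) else c.val y := by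
  by_cases h : y ∈ σ.supp
  · rw [Config.val, Config.permute_of_mem _ _ h]
    by_cases h' : y ∈ σ.copies
    · simp only [addition, Equiv.coe_fn_mk, h', if_true, Fin.val_add]
      rfl
    · simp only [addition, Equiv.coe_fn_mk, h', if_false]
      rfl
  · rw [Config.val, Config.permute_of_notMem _ _ h, if_neg fun h' => h (mem_supp.2 (.inr h')),
      Config.val]

theorem val_eq_permute_addition_symm (c : Config) (y : Reg) :
    c.val y = if y ∈ σ.copies then
      ((c.permute σ.addition.symm).val y + c.val (σ.ren y)) % (y.top + 1)
    else (c.permute σ.addition.symm).val y := by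
  have h := val_permute_addition (σ := σ) (c.permute σ.addition.symm)
  rw [Config.permute_permute_symm] at h
  rw [h y]
  split_ifs with hy
  · rw [h (σ.ren y), if_neg (notMem_copies_of_mem_dom (ren_mem_dom.2 hy))]
  · rfl

theorem act_permute_addition {c : Config} (hc : ∀ y ∈ σ.copies, c y = 0) :
    σ.ren.act (c.permute σ.addition) = c.permute σ.addition := by
  have val_eq_zero {y : Reg} (hy : y ∈ σ.copies) : c.val y = 0 := congrArg Fin.val (hc y hy)
  have val_lt (y : Reg) : c.val y < y.top + 1 := (c y).2
  refine Config.ext_val fun y => ?_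
  rw [Renaming.val_act, val_permute_addition, val_permute_addition, σ.ren.invol, σ.ren.top]
  by_cases hy : y ∈ σ.copies
  · rw [if_pos hy, if_neg (notMem_copies_of_mem_dom (ren_mem_dom.2 hy)), val_eq_zero hy, zero_add,
      Nat.mod_eq_of_lt (σ.ren.top y ▸ val_lt _)]
  · rw [if_neg hy]
    split_ifs with hr
    · rw [val_eq_zero hr, zero_add, Nat.mod_eq_of_lt (val_lt y)]
    · rw [ren_of_notMem_supp fun h => (mem_supp.1 h).elim (fun h => hr (ren_mem_copies.2 h)) hy]

/-! ### Forwarding -/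

section forwarding

variable {P : Protocol} (mem_regs_iff : ∀ y ∈ σ.supp, y ∈ P.regs ↔ y ∈ σ.dom)

include mem_regs_iff

theorem mem_copies_iff_notMem_regs (hy : y ∈ σ.supp) : y ∈ σ.copies ↔ y ∉ P.regs := by
  rw [mem_regs_iff y hy]
  exact ⟨fun h h' => notMem_copies_of_mem_dom h' h, (mem_supp.1 hy).resolve_left⟩

theorem ren_pairing (hy : y ∈ σ.supp) :
    (σ.ren y).quantum = y.quantum ∧ (σ.ren y).top = y.top ∧ (σ.ren y ∈ P.regs ↔ y ∉ P.regs) := by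
  refine ⟨σ.ren.quantum y, σ.ren.top y, ?_⟩
  rw [← mem_copies_iff_notMem_regs mem_regs_iff hy, mem_regs_iff _ (ren_mem_supp.2 hy), ren_mem_dom]

theorem isForwarding_exchange {b : Bool} (hb : ∀ y ∈ σ.supp, y.quantum = b) :
    (Op.ofPerm b hb σ.exchange).IsForwarding P := by
  refine ⟨σ.ren, σ.ren.invol, ?_⟩
  simp only [Op.targets_ofPerm, Op.branch_ofPerm, permute_exchange]
  exact ⟨fun y => mem_supp_iff_ren_ne, fun y => ren_pairing mem_regs_iff,
    .inl fun c => ⟨_, rfl, fun _ => rfl⟩⟩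

theorem isForwarding_addition (hb : ∀ y ∈ σ.supp, y.quantum = false) :
    (Op.ofPerm false hb σ.addition).IsForwarding P := by
  refine ⟨σ.ren, σ.ren.invol, ?_⟩
  simp only [Op.targets_ofPerm, Op.branch_ofPerm]
  refine ⟨fun y => mem_supp_iff_ren_ne, fun y => ren_pairing mem_regs_iff,
    .inr (.inl ⟨hb, fun c => ⟨_, rfl, fun y => ⟨fun hy hr => ?_, fun hy => Fin.ext ?_⟩⟩⟩)⟩
  · exact (val_permute_addition c y).trans
      (if_pos ((mem_copies_iff_notMem_regs mem_regs_iff hy).2 hr))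
  · exact (val_permute_addition c y).trans (if_neg fun h => hy.elim (fun h' =>
      h' (mem_supp.2 (.inr h))) ((mem_copies_iff_notMem_regs mem_regs_iff
        (mem_supp.2 (.inr h))).1 h))

theorem isForwarding_addition_symm (hb : ∀ y ∈ σ.supp, y.quantum = false) :
    (Op.ofPerm false hb σ.addition.symm).IsForwarding P := by
  refine ⟨σ.ren, σ.ren.invol, ?_⟩
  simp only [Op.targets_ofPerm, Op.branch_ofPerm]
  refine ⟨fun y => mem_supp_iff_ren_ne, fun y => ren_pairing mem_regs_iff,
    .inr (.inr ⟨hb, fun c => ⟨_, rfl, fun y => ⟨fun hy hr => ?_, fun hy => Fin.ext ?_⟩⟩⟩)⟩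
  · exact (val_eq_permute_addition_symm c y).trans
      (if_pos ((mem_copies_iff_notMem_regs mem_regs_iff hy).2 hr))
  · exact ((val_eq_permute_addition_symm c y).trans (if_neg fun h => hy.elim (fun h' =>
      h' (mem_supp.2 (.inr h))) ((mem_copies_iff_notMem_regs mem_regs_iff
        (mem_supp.2 (.inr h))).1 h))).symm

end forwarding

end Slot

/-! ### Transporting the registers of a gate to their copies -/

/-- How a register of a gate is transported to its copy and back: quantum registers and classical
registers that the gate modifies are exchanged with their copies. A channel register of which the
gate only reads the value may be read-only, so it is copied, and the copy is erased afterwards. -/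
inductive Kind where
  | quantum
  | modified
  | readOnly
deriving DecidableEq

namespace Kind

/-- The kinds, in the order in which they are handled before the gate. -/
def all : List Kind := [.quantum, .modified, .readOnly]

theorem nodup_all : all.Nodup := by decide

theorem mem_all (k : Kind) : k ∈ all := by cases k <;> decide

instance : Fintype Kind := ⟨⟨all, nodup_all⟩, mem_all⟩

end Kind

open Classical in
/-- The way in which a register of `g` is transported. -/
noncomputable def Gate.kind (g : Gate) (y : Reg) : Kind :=
  if y.quantum then .quantum else if g.Modifies y then .modified else .readOnly

theorem Gate.kind_eq_quantum {g : Gate} {y : Reg} : g.kind y = .quantum ↔ y.quantum = true := by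
  unfold kind
  split_ifs with hq <;> simp [hq]

theorem Gate.kind_eq_readOnly {g : Gate} {y : Reg} :
    g.kind y = .readOnly ↔ y.quantum = false ∧ ¬ g.Modifies y := by
  unfold kind
  by_cases hq : y.quantum = true
  · simp [hq]
  · by_cases hm : g.Modifies y <;> simp [hq, hm]

theorem Gate.modifies_of_kind_ne_readOnly {g : Gate} {y : Reg} (hy : y ∈ g.regs)
    (h : g.kind y ≠ .readOnly) : g.Modifies y := by
  by_contra hm
  refine h (kind_eq_readOnly.2 ⟨?_, hm⟩)
  by_contra hq
  exact hm (modifies_of_quantum hy (Bool.eq_true_of_not_eq_false hq))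

namespace Slot

variable (σ : Slot) (g : Gate)

/-- A permutation, for each kind, of the values of the registers of this kind and their copies. -/
abbrev Transport := ∀ k, Equiv.Perm (Asg (σ.part g.kind k).supp)

theorem quantum_of_mem_part (k : Kind) :
    ∀ y ∈ (σ.part g.kind k).supp, y.quantum = decide (k = .quantum) := fun y hy => by
  rw [Bool.eq_iff_iff, decide_eq_true_iff, ← quantum_original (σ := σ),
    ← Gate.kind_eq_quantum (g := g), ((mem_supp_part _).1 hy).2]

variable {σ g}

/-- The operation of a transport on the registers of kind `k` (`back = false`), or its inverse. -/
noncomputable def Transport.op (p : σ.Transport g) (k : Kind) (back : Bool) : Op :=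
  Op.ofPerm _ (σ.quantum_of_mem_part g k) (if back then (p k).symm else p k)

variable (σ g)

/-- The exchange of all registers with their copies. -/
noncomputable def swapping : σ.Transport g := fun _ => exchange _

/-- The exchange of registers with their copies, except that read-only registers are copied. -/
noncomputable def forwarding : σ.Transport g
  | .readOnly => addition _
  | _ => exchange _

variable {σ g}

theorem targets_op {p : σ.Transport g} {k : Kind} {back : Bool} :
    (p.op k back).targets = (σ.part g.kind k).supp :=
  Op.targets_ofPerm _ _

theorem isForwarding_op {P : Protocol} (h : ∀ y ∈ σ.supp, y ∈ P.regs ↔ y ∈ σ.dom) (k : Kind)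
    (back : Bool) : ((σ.forwarding g).op k back).IsForwarding P := by
  have mem_regs_iff : ∀ y ∈ (σ.part g.kind k).supp, y ∈ P.regs ↔ y ∈ (σ.part g.kind k).dom :=
    fun y hy => by
      obtain ⟨hs, hk⟩ := (mem_supp_part _).1 hy
      rw [h y hs]
      refine ⟨fun hd => Finset.mem_filter.2 ⟨hd, ?_⟩, fun hd => (Finset.mem_filter.1 hd).1⟩
      rwa [original_of_notMem (notMem_copies_of_mem_dom hd)] at hk
  have quantum_eq := σ.quantum_of_mem_part g k
  cases k <;> cases back
  · exact isForwarding_exchange mem_regs_iff quantum_eq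
  · exact isForwarding_exchange mem_regs_iff quantum_eq
  · exact isForwarding_exchange mem_regs_iff quantum_eq
  · exact isForwarding_exchange mem_regs_iff quantum_eq
  · exact isForwarding_addition mem_regs_iff quantum_eq
  · exact isForwarding_addition_symm mem_regs_iff quantum_eq

theorem modifies_of_modifies_op (hσ : σ.dom ⊆ g.regs) {G : Finset (Reg × ℕ)} {k : Kind}
    {back : Bool} {y : Reg} (hy : y.name < σ.bound)
    (h : (Gate.guarded G ((σ.forwarding g).op k back)).Modifies y) : g.Modifies y := by
  obtain ⟨ht, h⟩ := h
  have hs : y ∈ (σ.part g.kind k).supp := targets_op.subset ht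
  obtain ⟨hd, hk⟩ := Finset.mem_filter.1 ((mem_supp_iff_of_lt (σ := σ.part g.kind k) hy).1 hs)
  refine Gate.modifies_of_kind_ne_readOnly (hσ hd) ?_
  rw [hk]
  rintro rfl
  have hq : y.quantum = false := quantum_of_mem_part σ g .readOnly y hs
  obtain h | ⟨c, c', x, hb, hne⟩ := h
  · exact absurd (hq.symm.trans h) (by decide)
  refine hne (Fin.ext ?_)
  have hb : ((σ.forwarding g).op .readOnly back).branch x c c' ≠ 0 := hb
  rw [Transport.op, Op.branch_ofPerm] at hb
  obtain ⟨rfl, -⟩ := Finsupp.single_apply_ne_zero.1 hb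
  have hy' : y ∉ (σ.part g.kind .readOnly).copies := notMem_copies_of_lt hy
  cases back
  · exact (val_permute_addition c y).trans (if_neg hy')
  · exact ((val_eq_permute_addition_symm c y).trans (if_neg hy')).symm

/-- The effect of a transport on the basis values. -/
noncomputable def Transport.apply (p : σ.Transport g) (c : Config) : Config :=
  Kind.all.foldl (fun c k => c.permute (p k)) c

/-- The effect of the inverse of a transport on the basis values. -/
noncomputable def Transport.unapply (p : σ.Transport g) (c : Config) : Config :=
  Kind.all.reverse.foldl (fun c k => c.permute (p k).symm) c

theorem unapply_apply (p : σ.Transport g) (c : Config) : p.unapply (p.apply c) = c := by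
  simp only [Transport.apply, Transport.unapply, Kind.all, List.reverse_cons, List.reverse_nil,
    List.nil_append, List.cons_append, List.foldl_cons, List.foldl_nil,
    Config.permute_symm_permute]

theorem apply_of_notMem_supp (p : σ.Transport g) (c : Config) {y : Reg} (hy : y ∉ σ.supp) :
    p.apply c y = c y := by
  have notMem (k : Kind) : y ∉ (σ.part g.kind k).supp := fun h => hy ((mem_supp_part _).1 h).1
  simp only [Transport.apply, Kind.all, List.foldl_cons, List.foldl_nil,
    Config.permute_of_notMem _ _ (notMem _)]

theorem apply_swapping (c : Config) : (σ.swapping g).apply c = σ.ren.act c := by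
  rw [← foldl_act_part Kind.nodup_all fun y => Kind.mem_all (g.kind y)]
  simp only [Transport.apply, swapping, permute_exchange]

theorem unapply_swapping (c : Config) : (σ.swapping g).unapply c = σ.ren.act c := by
  rw [← foldl_act_part (List.nodup_reverse.2 Kind.nodup_all)
    fun y => List.mem_reverse.2 (Kind.mem_all (g.kind y))]
  simp only [← permute_exchange]
  rfl

end Slot

/-- All registers whose name is at least `N` have the value zero. -/
def Clean (N : ℕ) (c : Config) : Prop := ∀ y : Reg, N ≤ y.name → c y = 0

/-- The superpositions of clean basis values. -/
noncomputable def cleanStates (N : ℕ) : Submodule ℂ State := Finsupp.supported ℂ ℂ {c | Clean N c}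

theorem eqOn_cleanStates {N : ℕ} {f f' : State →ₗ[ℂ] State}
    (h : ∀ c, Clean N c → f (Finsupp.single c 1) = f' (Finsupp.single c 1)) {s : State}
    (hs : s ∈ cleanStates N) : f s = f' s := by
  rw [cleanStates, Finsupp.supported_eq_span_single] at hs
  refine LinearMap.eqOn_span ?_ hs
  rintro _ ⟨c, hc, rfl⟩
  exact h c hc

theorem Gate.kraus_mem_cleanStates {N : ℕ} {g : Gate} (hg : ∀ y ∈ g.regs, y.name < N) (x : ℕ)
    {s : State} (hs : s ∈ cleanStates N) : g.kraus x s ∈ cleanStates N := fun _ hc' => by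
  obtain ⟨c, hc, h⟩ := exists_of_mem_support_kraus hc'
  intro y hy
  rw [h y fun hm => (hg y hm.mem_regs).not_ge hy]
  exact hs hc y hy

namespace Slot

variable {σ : Slot} {g : Gate}

theorem apply_forwarding {c : Config} (hc : Clean σ.bound c) :
    (σ.forwarding g).apply c =
      σ.ren.act (c.permute (σ.part g.kind .readOnly).addition) := by
  have copies_eq_zero : ∀ y ∈ (σ.part g.kind .readOnly).copies, c y = 0 := fun y hy => by
    obtain ⟨z, -, rfl⟩ := Finset.mem_image.1 hy
    exact hc _ bound_le_name_copy
  have nodup : [Kind.readOnly, .quantum, .modified].Nodup := by decide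
  have mem : ∀ k, k ∈ [Kind.readOnly, .quantum, .modified] := fun k => by cases k <;> decide
  rw [← foldl_act_part nodup fun y => mem (g.kind y)]
  simp only [List.foldl_cons, List.foldl_nil, act_permute_addition copies_eq_zero]
  simp only [← permute_exchange]
  have disjoint {k : Kind} (h : .readOnly ≠ k) :=
    disjoint_supp_part (σ := σ) g.kind (i := .readOnly) h
  rw [Config.permute_comm (disjoint (k := .quantum) (by decide)),
    Config.permute_comm (disjoint (k := .modified) (by decide))]
  rfl

/-! ### Conjugating a gate by a transport -/

/-- The gates of a transport that is controlled by `G`. -/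
noncomputable def Transport.gate (p : σ.Transport g) (G : Finset (Reg × ℕ)) (k : Kind)
    (back : Bool) : Gate :=
  Gate.guarded G (p.op k back)

/-- The gates that are executed before the transported gate. -/
noncomputable def Transport.before (p : σ.Transport g) (G : Finset (Reg × ℕ)) : List Gate :=
  Kind.all.map fun k => p.gate G k false

/-- The gates that are executed after the transported gate. -/
noncomputable def Transport.after (p : σ.Transport g) (G : Finset (Reg × ℕ)) : List Gate :=
  Kind.all.reverse.map fun k => p.gate G k true

theorem run_before {p : σ.Transport g} {G : Finset (Reg × ℕ)}
    (hG : ∀ q ∈ G, q.1.quantum = false ∧ q.1 ∉ σ.supp) (s : State) :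
    run (p.before G) s = s.mapDomain (Config.whenever G p.apply) :=
  run_guarded_ofPerm (fun k => σ.quantum_of_mem_part g k) p
    (fun q hq => ⟨(hG q hq).1, fun _ h => (hG q hq).2 ((mem_supp_part _).1 h).1⟩) _ s

theorem run_after {p : σ.Transport g} {G : Finset (Reg × ℕ)}
    (hG : ∀ q ∈ G, q.1.quantum = false ∧ q.1 ∉ σ.supp) (s : State) :
    run (p.after G) s = s.mapDomain (Config.whenever G p.unapply) :=
  run_guarded_ofPerm (fun k => σ.quantum_of_mem_part g k) (fun k => (p k).symm)
    (fun q hq => ⟨(hG q hq).1, fun _ h => (hG q hq).2 ((mem_supp_part _).1 h).1⟩) _ s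

theorem run_swapping (x : ℕ) (s : State) :
    run ((σ.swapping g).after ∅) (g.kraus x (run ((σ.swapping g).before ∅) s)) =
      (g.rename σ.ren).kraus x s := by
  have holds (c : Config) : c.Holds ∅ := fun _ h => absurd h (Finset.notMem_empty _)
  have apply_eq : Config.whenever ∅ (σ.swapping g).apply = σ.ren.act := funext fun c =>
    (Config.whenever_of_holds (holds c)).trans (apply_swapping c)
  have unapply_eq : Config.whenever ∅ (σ.swapping g).unapply = σ.ren.act := funext fun c =>
    (Config.whenever_of_holds (holds c)).trans (unapply_swapping c)
  have act_comp_act : σ.ren.act ∘ σ.ren.act = id := funext σ.ren.act_act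
  rw [run_before (by simp), run_after (by simp), apply_eq, unapply_eq,
    ← Gate.kraus_rename_mapDomain, ← Finsupp.mapDomain_comp, act_comp_act, Finsupp.mapDomain_id]

theorem kraus_mapDomain_addition (hg : ∀ y ∈ g.regs, y.name < σ.bound) (x : ℕ) (s : State) :
    g.kraus x (s.mapDomain (Config.permute (σ.part g.kind .readOnly).addition)) =
      (g.kraus x s).mapDomain (Config.permute (σ.part g.kind .readOnly).addition) := by
  have notMem_copies {y : Reg} (hy : y ∈ g.regs) : y ∉ (σ.part g.kind .readOnly).copies :=
    notMem_copies_of_lt (hg y hy)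
  refine Gate.kraus_mapDomain (fun c y hy => Fin.ext ?_) (fun c c' h y hy => Fin.ext ?_) x s
  · exact (val_permute_addition c y).trans (if_neg (notMem_copies hy))
  · have val_eq {z : Reg} (hz : ¬ g.Modifies z) : c'.val z = c.val z := congrArg Fin.val (h z hz)
    refine (val_permute_addition c' y).trans (Eq.trans ?_ (val_permute_addition c y).symm)
    rw [val_eq fun hm => hy hm.1]
    split_ifs with hc
    · have hr := ren_mem_dom.2 hc
      rw [val_eq (Gate.kind_eq_readOnly.1 (Finset.mem_filter.1 hr).2).2]
    · rfl

theorem unload_kraus_load {G : Finset (Reg × ℕ)} (hG : G ⊆ g.guard) (hσ : ∀ q ∈ G, q.1 ∉ σ.supp)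
    (hg : ∀ y ∈ g.regs, y.name < σ.bound) (x : ℕ) {c : Config} (hc : Clean σ.bound c)
    (h : c.Holds G) :
    ((g.rename σ.ren).kraus x (Finsupp.single ((σ.forwarding g).apply c) 1)).mapDomain
      (Config.whenever G (σ.forwarding g).unapply) = g.kraus x (Finsupp.single c 1) := by
  rw [apply_forwarding hc, ← Finsupp.mapDomain_single, ← Finsupp.mapDomain_single,
    Gate.kraus_rename_mapDomain, kraus_mapDomain_addition hg, ← Finsupp.mapDomain_comp,
    ← Finsupp.mapDomain_comp]
  conv_rhs => rw [← Finsupp.mapDomain_id (v := g.kraus x (Finsupp.single c 1))]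
  refine Finsupp.mapDomain_congr fun c' hc' => ?_
  have clean : Clean σ.bound c' :=
    Gate.kraus_mem_cleanStates hg x (Finsupp.single_mem_supported ℂ 1 hc) hc'
  obtain ⟨d, hd, eq_of_not_modifies⟩ := Gate.exists_of_mem_support_kraus hc'
  obtain rfl := Finset.mem_singleton.1 (Finsupp.support_single_subset hd)
  have holds : ((σ.forwarding g).apply c').Holds G := fun q hq => by
    rw [apply_of_notMem_supp _ _ (hσ q hq),
      eq_of_not_modifies _ fun hm => g.guard_target q (hG hq) hm.1]
    exact h q hq
  simp only [Function.comp_apply]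
  rw [← apply_forwarding clean, Config.whenever_of_holds holds, unapply_apply, id]

theorem run_forwarding {G : Finset (Reg × ℕ)} (hG : G ⊆ g.guard)
    (hd : ∀ q ∈ G, q.1 ∉ σ.dom) (hg : ∀ y ∈ g.regs, y.name < σ.bound) (x : ℕ) {s : State}
    (hs : s ∈ cleanStates σ.bound) :
    run ((σ.forwarding g).after G)
      ((g.rename σ.ren).kraus x (run ((σ.forwarding g).before G) s)) = g.kraus x s := by
  have hG' : ∀ q ∈ G, q.1.quantum = false ∧ q.1 ∉ σ.supp := fun q hq => by
    have hlt := hg q.1 (Gate.mem_regs_of_mem_guard (hG hq))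
    exact ⟨g.guard_classical q (hG hq), fun h => hd q hq ((mem_supp_iff_of_lt hlt).1 h)⟩
  rw [← LinearMap.comp_apply, ← LinearMap.comp_apply]
  refine eqOn_cleanStates (fun c hc => ?_) hs
  rw [LinearMap.comp_apply, LinearMap.comp_apply, run_before hG', run_after hG',
    Finsupp.mapDomain_single]
  by_cases h : c.Holds G
  · rw [Config.whenever_of_holds h]
    exact unload_kraus_load hG (fun q hq => (hG' q hq).2) hg x hc h
  · have not_active : ¬ g.Active c := fun ha => h fun q hq => ha q (hG hq)
    have not_active' : ¬ (g.rename σ.ren).Active c := fun ha => h fun q hq => by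
      have := ha _ (Finset.mem_image_of_mem _ (hG hq))
      rwa [ren_of_notMem_supp (hG' q hq).2] at this
    rw [Config.whenever_of_not_holds h, Gate.kraus_single_of_not_active not_active,
      Gate.kraus_single_of_not_active not_active']
    split_ifs
    · rw [Finsupp.mapDomain_single, Config.whenever_of_not_holds h]
    · exact Finsupp.mapDomain_zero

end Slot

/-! ### Orders and executions -/

/-- A list of all elements, each one once, in an order that is compatible with `r`. -/
structure IsListing {ι : Type} (r : ι → ι → Prop) (l : List ι) : Prop where
  nodup : l.Nodup
  all : ∀ i, i ∈ l
  compatible : l.Pairwise fun i j => ¬ r j i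

theorem Circuit.isExecution_iff {C : Circuit} {v : Config} {l : List C.Idx} :
    C.IsExecution v l ↔ IsListing (C.lt v) l :=
  ⟨fun h => ⟨h.nodup, h.all, h.compatible⟩, fun h => ⟨h.nodup, h.all, h.compatible⟩⟩

theorem StrictOrder.exists_isListing {ι : Type} [Finite ι] {r : ι → ι → Prop}
    (h : StrictOrder r) : ∃ l, IsListing r l := by
  classical
  have := Fintype.ofFinite ι
  have : IsStrictOrder ι r := { irrefl := h.1, trans := h.2 }
  let := partialOrderOfSO r
  obtain ⟨s, _, hs⟩ := extend_partialOrder (α := ι) (· ≤ ·)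
  refine ⟨Finset.univ.sort s, Finset.sort_nodup _ _, fun i => by simp, ?_⟩
  refine (Finset.pairwise_sort _ s).imp fun {i j} (hij : s i j) (hji : r j i) => h.1 i ?_
  have e : i = j := antisymm hij (hs j i (le_of_lt (α := ι) hji))
  rwa [← e] at hji

namespace IsListing

variable {ι : Type} {r : ι → ι → Prop} {l m : List ι}

theorem eq_of_total (hr : ∀ i j, i ≠ j → r i j ∨ r j i) (hl : IsListing r l)
    (hm : IsListing r m) : l = m := by
  refine List.Perm.eq_of_pairwise (le := fun i j => ¬ r j i) ?_ hl.compatible hm.compatible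
    ((List.perm_ext_iff_of_nodup hl.nodup hm.nodup).2 fun i => by simp [hl.all, hm.all])
  intro i j _ _ hji hij
  by_contra hne
  exact (hr i j hne).elim hij hji

variable [DecidableEq ι]

theorem idxOf_lt_or_gt (h : IsListing r l) {i j : ι} (hij : i ≠ j) :
    l.idxOf i < l.idxOf j ∨ l.idxOf j < l.idxOf i :=
  lt_or_gt_of_ne fun e => hij ((List.idxOf_inj (h.all i)).1 e)

theorem idxOf_lt_of_rel (h : IsListing r l) (hr : StrictOrder r) {i j : ι} (hij : r i j) :
    l.idxOf i < l.idxOf j := by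
  have hne : i ≠ j := fun e => hr.1 j (e ▸ hij)
  refine (h.idxOf_lt_or_gt hne).resolve_right fun hlt => ?_
  have hnot := List.pairwise_iff_getElem.1 h.compatible _ _
    (List.idxOf_lt_length_of_mem (h.all j)) (List.idxOf_lt_length_of_mem (h.all i)) hlt
  rw [List.getElem_idxOf, List.getElem_idxOf] at hnot
  exact hnot hij

theorem idxOf (h : IsListing r l) : IsListing (fun i j => l.idxOf i < l.idxOf j) l := by
  refine ⟨h.nodup, h.all, List.pairwise_iff_getElem.2 fun m n hm hn hmn => ?_⟩
  rw [h.nodup.idxOf_getElem, h.nodup.idxOf_getElem]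
  exact hmn.not_gt

end IsListing

/-! ### Refinements -/

/-- The replacement of each `i : ι` by a list `block i` of elements of `κ`, which are sorted by
`pos`. -/
structure Refinement (ι κ : Type) where
  proj : κ → ι
  pos : κ → ℕ
  block : ι → List κ
  mem_block : ∀ i k, k ∈ block i ↔ proj k = i
  sorted_block : ∀ i, (block i).Pairwise fun k m => pos k < pos m

namespace Refinement

variable {ι κ : Type} (R : Refinement ι κ) {r : ι → ι → Prop}

/-- The lexicographic order on the elements of the blocks, when the blocks are ordered by `r`. -/
def order (r : ι → ι → Prop) (k m : κ) : Prop :=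
  r (R.proj k) (R.proj m) ∨ R.proj k = R.proj m ∧ R.pos k < R.pos m

variable {R}

theorem strictOrder (h : StrictOrder r) : StrictOrder (R.order r) := by
  refine ⟨fun k => not_or_intro (h.1 _) fun hk => lt_irrefl _ hk.2, fun k m n hkm hmn => ?_⟩
  obtain hkm | ⟨hkm, pos_km⟩ := hkm <;> obtain hmn | ⟨hmn, pos_mn⟩ := hmn
  · exact .inl (h.2 _ _ _ hkm hmn)
  · exact .inl (hmn ▸ hkm)
  · exact .inl (hkm ▸ hmn)
  · exact .inr ⟨hkm.trans hmn, pos_km.trans pos_mn⟩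

theorem comparable {k m : κ} (hkm : k ≠ m)
    (h : R.proj k ≠ R.proj m → r (R.proj k) (R.proj m) ∨ r (R.proj m) (R.proj k)) :
    R.order r k m ∨ R.order r m k := by
  by_cases hp : R.proj k = R.proj m
  · have pos_ne : R.pos k ≠ R.pos m := by
      have : Std.Symm fun k m => R.pos k ≠ R.pos m := ⟨fun _ _ h => h.symm⟩
      exact ((R.sorted_block (R.proj m)).imp fun hlt => hlt.ne).forall
        ((R.mem_block _ _).2 hp) ((R.mem_block _ _).2 rfl) hkm
    exact pos_ne.lt_or_gt.imp (fun h => .inr ⟨hp, h⟩) fun h => .inr ⟨hp.symm, h⟩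
  · exact (h hp).imp .inl .inl

theorem isListing_flatMap (hr : ∀ i, ¬ r i i) {l : List ι} (hl : IsListing r l) :
    IsListing (R.order r) (l.flatMap R.block) where
  nodup := by
    refine List.nodup_flatMap.2
      ⟨fun i _ => (R.sorted_block i).imp fun hlt e => hlt.ne (by rw [e]), ?_⟩
    exact hl.nodup.imp fun {i j} hij k hi hj =>
      hij (((R.mem_block i k).1 hi).symm.trans ((R.mem_block j k).1 hj))
  all k := List.mem_flatMap.2 ⟨R.proj k, hl.all _, (R.mem_block _ k).2 rfl⟩
  compatible := by
    refine List.pairwise_flatMap.2 ⟨fun i _ => ?_, ?_⟩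
    · refine (R.sorted_block i).imp_of_mem fun {k m} hk hm hlt => ?_
      rw [mem_block] at hk hm
      rw [order, hk, hm]
      exact not_or_intro (hr i) fun h => h.2.not_gt hlt
    · refine (hl.compatible.and hl.nodup).imp fun {i j} hij k hk m hm => ?_
      rw [mem_block] at hk hm
      rw [order, hk, hm]
      exact not_or_intro hij.1 fun h => hij.2 h.1.symm

variable (R)

/-- A refinement of the left elements of a sum. -/
def sum (ι' : Type) : Refinement (ι ⊕ ι') (κ ⊕ ι') where
  proj := Sum.map R.proj id
  pos := Sum.elim R.pos fun _ => 0
  block := Sum.elim (fun i => (R.block i).map .inl) fun j => [.inr j]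
  mem_block i k := by
    rcases i with i | j <;> rcases k with k | j' <;> simp [R.mem_block]
  sorted_block i := by
    rcases i with i | j <;> simp [List.pairwise_map, R.sorted_block]

/-- A refinement with relabelled elements. -/
def comap {κ' : Type} (e : κ' ≃ κ) : Refinement ι κ' where
  proj := R.proj ∘ e
  pos := R.pos ∘ e
  block i := (R.block i).map e.symm
  mem_block i k := by
    simp [← R.mem_block, Equiv.symm_apply_eq]
  sorted_block i := by
    simpa [List.pairwise_map] using R.sorted_block i

end Refinement

/-- The position of the forwarding gate for the kind `k` in a block with the main gate at `3`. -/
def Kind.pos (k : Kind) (back : Bool) : ℕ :=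
  if back then 6 - all.idxOf k else all.idxOf k

/-- Each element that satisfies `p` is put between one element for each kind of register, and these
elements in the reverse order. -/
def wrap {ι : Type} (p : ι → Prop) [DecidablePred p] :
    Refinement ι (ι ⊕ {i // p i} × Kind × Bool) where
  proj := Sum.elim id fun a => a.1
  pos := Sum.elim (fun _ => 3) fun a => a.2.1.pos a.2.2
  block i := if h : p i then
      Kind.all.map (fun k => .inr (⟨i, h⟩, k, false)) ++
        .inl i :: Kind.all.reverse.map fun k => .inr (⟨i, h⟩, k, true)
    else [.inl i]
  mem_block i k := by
    rcases k with j | ⟨⟨j, hj⟩, k, back⟩ <;> by_cases h : p i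
    · simp [h, eq_comm]
    · simp [h, eq_comm]
    · cases back <;> simp [h, Kind.mem_all, eq_comm]
    · simpa [h] using fun e : j = i => h (e ▸ hj)
  sorted_block i := by
    split_ifs
    · simp [Kind.all, Kind.pos]
    · simp

namespace Refinement

theorem map_block_sum_inl {ι κ ι' α : Type} (R : Refinement ι κ) (i : ι) (f : κ → α)
    (f' : ι' → α) : ((R.sum ι').block (.inl i)).map (Sum.elim f f') = (R.block i).map f :=
  List.map_map

theorem prob_flatMap {C D : Circuit} (R : Refinement C.Idx D.Idx) {Z : Reg}
    {V : Submodule ℂ State} (invariant : ∀ i x, ∀ s ∈ V, (C.gate i).kraus x s ∈ V)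
    (replace : ∀ i m, ∀ s ∈ V,
      probZero Z ((R.block i).map D.gate ++ m) s = probZero Z (C.gate i :: m) s)
    {v : Config} (hv : Finsupp.single v 1 ∈ V) (l : List C.Idx) :
    D.prob Z v (l.flatMap R.block) = C.prob Z v l := by
  rw [Circuit.prob, List.map_flatMap]
  exact probZero_flatMap invariant replace l hv

end Refinement

section wrap

variable {ι : Type} {p : ι → Prop} [DecidablePred p]

theorem probZero_map_block_wrap {g g' : ι → Gate} {t : {i // p i} × Kind × Bool → Gate}
    (numOut_t : ∀ a, (t a).op.numOut = 1) {i : ι}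
    (numOut_eq : (g' i).op.numOut = (g i).op.numOut) {s : State}
    (kraus_of_pos : ∀ (h : p i) x,
      run (Kind.all.reverse.map fun k => t (⟨i, h⟩, k, true))
        ((g' i).kraus x (run (Kind.all.map fun k => t (⟨i, h⟩, k, false)) s)) = (g i).kraus x s)
    (kraus_of_neg : ¬ p i → ∀ x, (g' i).kraus x s = (g i).kraus x s) (Z : Reg) (m : List Gate) :
    probZero Z (((wrap p).block i).map (Sum.elim g' t) ++ m) s = probZero Z (g i :: m) s := by
  by_cases h : p i
  · have block_eq : ((wrap p).block i).map (Sum.elim g' t) ++ m =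
        (Kind.all.map fun k => t (⟨i, h⟩, k, false)) ++
          g' i :: (Kind.all.reverse.map fun k => t (⟨i, h⟩, k, true)) ++ m := by
      simp [wrap, h, Function.comp_def]
    rw [block_eq]
    refine probZero_sandwich ?_ ?_ numOut_eq (kraus_of_pos h) <;>
      exact List.forall_mem_map.2 fun k _ => numOut_t _
  · have block_eq : ((wrap p).block i).map (Sum.elim g' t) ++ m = [] ++ g' i :: [] ++ m := by
      simp [wrap, h]
    rw [block_eq]
    exact probZero_sandwich (by simp) (by simp) numOut_eq (kraus_of_neg h)

theorem card_wrap_le [Fintype ι] :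
    Fintype.card ({i // p i} × Kind × Bool) ≤ 6 * Fintype.card ι := by
  have := Fintype.card_subtype_le p
  rw [Fintype.card_prod, show Fintype.card (Kind × Bool) = 6 from rfl]
  omega

end wrap

theorem Slot.numOut_gate {σ : Slot} {g : Gate} {p : σ.Transport g} {G : Finset (Reg × ℕ)}
    {k : Kind} {back : Bool} : (p.gate G k back).op.numOut = 1 :=
  Op.numOut_ofPerm _ _

theorem Slot.kraus_rename_of_dom_eq_empty {σ : Slot} (h : σ.dom = ∅) (g : Gate) (x : ℕ)
    (s : State) : (g.rename σ.ren).kraus x s = g.kraus x s := by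
  have act_eq : σ.ren.act = id := by
    funext c
    refine Config.ext_val fun y => (σ.ren.val_act c y).trans ?_
    rw [ren_of_notMem_supp (by simp [supp, copies, h])]
    rfl
  have := Gate.kraus_rename_mapDomain (g := g) σ.ren x s
  rwa [act_eq, Finsupp.mapDomain_id, Finsupp.mapDomain_id] at this

/-! ### Protocols and their adversaries -/

theorem Status.advGate_iff {s : Status} {g : Gate} :
    s.AdvGate g ↔ s ≠ .honest ∧ s.advGuard ⊆ g.guard := by
  cases s <;> simp [AdvGate, advGuard]

namespace Protocol

variable {P : Protocol}

variable (P) in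
theorem finite_internal : P.internal.Finite := by
  have : Finite P.Role := @Finite.of_fintype _ P.roleFin
  have internal_eq : P.internal = (⋃ r, (P.priv r : Set Reg)) ∪ P.chan := by
    ext y
    simp [internal]
  rw [internal_eq]
  exact (Set.finite_iUnion fun r => (P.priv r).finite_toSet).union P.chan.finite_toSet

variable (P) in
theorem finite_corr : P.corr.Finite := by
  have : Finite P.Role := @Finite.of_fintype _ P.roleFin
  refine (Set.finite_iUnion fun r => ((P.status r).advGuard.image Prod.fst).finite_toSet).subset ?_
  rintro y ⟨r, hr⟩
  exact Set.mem_iUnion.2 ⟨r, by simp [hr, Status.advGuard]⟩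

variable (P) in
theorem finite_regs : P.regs.Finite :=
  P.finite_internal.union (P.io.finite_toSet.union P.finite_corr)

theorem mem_corr_of_mem_advGuard {r : P.Role} {q : Reg × ℕ}
    (hq : q ∈ (P.status r).advGuard) : q.1 ∈ P.corr := by
  refine ⟨r, ?_⟩
  cases hs : P.status r <;> simp_all [Status.advGuard]

namespace WellFormed

variable (hP : P.WellFormed)
include hP

theorem mem_regs_of_mem_body {i : P.body.Idx} {y : Reg} (hy : y ∈ (P.body.gate i).regs) :
    y ∈ P.regs := by
  obtain h | ⟨h | h, -⟩ | ⟨h, -⟩ := hP.access i y hy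
  · exact .inl (.inl ⟨_, h⟩)
  · exact .inl (.inr h)
  · exact .inr (.inl h)
  · exact .inr (.inr ⟨_, h⟩)

theorem notMem_io_of_mem_internal {y : Reg} (hy : y ∈ P.internal) : y ∉ P.io := by
  obtain ⟨r, hr⟩ | hc := hy
  · exact Finset.disjoint_left.1 (hP.priv_io r) hr
  · exact Finset.disjoint_left.1 hP.chan_io hc

theorem act_mem_channel {i : P.body.Idx} {a : Reg} (h : P.act i = some a) :
    a ∈ P.chan ∨ a ∈ P.io :=
  (hP.act_guard i a h).2

end WellFormed

theorem mem_regs_of_mem_channel {y : Reg} (h : y ∈ P.chan ∨ y ∈ P.io) : y ∈ P.regs :=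
  h.elim (fun h => .inl (.inr h)) fun h => .inr (.inl h)

end Protocol

namespace Env

variable {P : Protocol} {I : IdealProtocol P} {E : Env P}

/-! ### The registers that are transported -/

section bound

variable (I E) in
/-- All registers in use on the analysed side and on the ideal side. -/
def usedRegs : Set Reg :=
  {y | y ∈ E.own ∨ (∃ e, y ∈ (E.gate e).regs) ∨ y ∈ P.regs ∨ y ∈ I.internal}

theorem finite_usedRegs : (E.usedRegs I).Finite := by
  have usedRegs_eq : E.usedRegs I =
      ↑E.own ∪ ((⋃ e, ↑(E.gate e).regs) ∪ (P.regs ∪ I.internal)) := by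
    ext y
    simp only [usedRegs, Set.mem_ofPred_eq, Set.mem_union, Set.mem_iUnion, SetLike.mem_coe]
  rw [usedRegs_eq]
  exact E.own.finite_toSet.union ((Set.finite_iUnion fun e => (E.gate e).regs.finite_toSet).union
    (P.finite_regs.union I.finite_internal))

theorem exists_name_lt : ∃ N, ∀ y ∈ E.usedRegs I, y.name < N := by
  obtain ⟨N, hN⟩ := (E.finite_usedRegs (I := I).image Reg.name).bddAbove
  exact ⟨N + 1, fun y hy => Nat.lt_succ_of_le (hN ⟨y, hy, rfl⟩)⟩

variable (I E) in
/-- A bound for the names of the registers in use; the names of fresh registers start here. -/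
noncomputable def bound : ℕ := (exists_name_lt (I := I) (E := E)).choose

variable {y : Reg}

theorem name_lt_bound (h : y ∈ E.usedRegs I) : y.name < E.bound I :=
  (exists_name_lt (I := I) (E := E)).choose_spec y h

theorem name_lt_of_mem_own (h : y ∈ E.own) : y.name < E.bound I := name_lt_bound (.inl h)

theorem name_lt_of_mem_gate {e : E.App ⊕ E.Adv} (h : y ∈ (E.gate e).regs) :
    y.name < E.bound I :=
  name_lt_bound (.inr (.inl ⟨e, h⟩))

theorem name_lt_of_mem_protocol (h : y ∈ P.regs) : y.name < E.bound I :=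
  name_lt_bound (.inr (.inr (.inl h)))

theorem name_lt_of_mem_ideal (h : y ∈ I.internal) : y.name < E.bound I :=
  name_lt_bound (.inr (.inr (.inr h)))

end bound

variable (E) in
open Classical in
/-- The circuit in whose name the dummy adversary forwards registers for a gate of the environment:
that of an adversary gate, and for an application gate one that is corrupted all the time. -/
noncomputable def mover : E.App ⊕ E.Adv → Option P.Role
  | .inl _ => if h : P.HasEve then some h.choose else none
  | .inr a => some (E.role a)

variable (E) in
/-- The gates of the environment for which the dummy adversary forwards registers. -/
abbrev Moved : Type := {e // (E.mover e).isSome}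

variable (E) in
/-- The circuit in whose name registers are forwarded. -/
noncomputable def moverRole (e : E.Moved) : P.Role := (E.mover e.1).get e.2

theorem isSome_mover_of_hasEve (h : P.HasEve) (e : E.App ⊕ E.Adv) : (E.mover e).isSome := by
  cases e <;> simp [mover, h]

theorem Valid.advGate (hE : E.Valid I) (e : E.Moved) :
    (P.status (E.moverRole e)).AdvGate (E.gate e.1) := by
  obtain ⟨a | a, he⟩ := e
  · have hEve : P.HasEve := by
      by_contra h
      simp [mover, h] at he
    have role_eq : E.moverRole ⟨.inl a, he⟩ = hEve.choose := by simp [moverRole, mover, hEve]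
    rw [role_eq, hEve.choose_spec]
    trivial
  · exact (hE.adv a).1

theorem Valid.advGuard_subset (hE : E.Valid I) (e : E.Moved) :
    (P.status (E.moverRole e)).advGuard ⊆ (E.gate e.1).guard :=
  (Status.advGate_iff.1 (hE.advGate e)).2

variable (I E) in
open Classical in
/-- The private registers and internal channel registers of the protocol that a gate of the
environment accesses, if they are forwarded for it, with fresh copies. -/
noncomputable def slot (e : E.App ⊕ E.Adv) : Slot where
  bound := E.bound I
  key := Fintype.equivFin (E.App ⊕ E.Adv) e
  dom := (E.gate e).regs.filter fun y => y ∈ P.internal ∧ (E.mover e).isSome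
  small _ hy := name_lt_of_mem_gate (Finset.mem_filter.1 hy).1

section slot

variable {e f : E.App ⊕ E.Adv} {y z : Reg}

theorem mem_dom_slot :
    y ∈ (E.slot I e).dom ↔ y ∈ (E.gate e).regs ∧ y ∈ P.internal ∧ (E.mover e).isSome := by
  simp [slot]

theorem mem_internal_of_mem_dom (hy : y ∈ (E.slot I e).dom) : y ∈ P.internal :=
  (mem_dom_slot.1 hy).2.1

theorem dom_slot_subset : (E.slot I e).dom ⊆ (E.gate e).regs := fun _ hy =>
  (mem_dom_slot.1 hy).1

theorem dom_slot_of_not_isSome (h : ¬ (E.mover e).isSome) : (E.slot I e).dom = ∅ :=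
  Finset.eq_empty_of_forall_notMem fun _ hy => h (mem_dom_slot.1 hy).2.2

theorem eq_of_mem_copies (he : y ∈ (E.slot I e).copies) (hf : y ∈ (E.slot I f).copies) :
    e = f := by
  obtain ⟨z, -, rfl⟩ := Finset.mem_image.1 he
  obtain ⟨w, -, copy_eq⟩ := Finset.mem_image.1 hf
  have name_eq := congrArg Reg.name copy_eq
  simp only [Slot.copy, slot, Nat.add_left_cancel_iff, Nat.pair_eq_pair] at name_eq
  exact (Fintype.equivFin _).injective (Fin.ext name_eq.1.symm)

theorem bound_le_of_mem_copies (h : y ∈ (E.slot I e).copies) : E.bound I ≤ y.name := by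
  obtain ⟨z, -, rfl⟩ := Finset.mem_image.1 h
  exact Slot.bound_le_name_copy (σ := E.slot I e)

theorem mem_regs_iff_mem_dom (h : y ∈ (E.slot I e).supp) :
    y ∈ P.regs ↔ y ∈ (E.slot I e).dom := by
  refine ⟨fun hy => ?_, fun hy => .inl (mem_internal_of_mem_dom hy)⟩
  exact (Slot.mem_supp_iff_of_lt (name_lt_of_mem_protocol hy)).1 h

end slot

end Env

/-! ### The reduction to a dummy adversary -/

theorem Refinement.isCircuit {C D : Circuit} (R : Refinement C.Idx D.Idx)
    (lt_eq : ∀ v, D.lt v = R.order (C.lt v))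
    (mem_regs_proj : ∀ k m y, R.proj k ≠ R.proj m → y ∈ (D.gate k).regs → y ∈ (D.gate m).regs →
      y ∈ (C.gate (R.proj k)).regs)
    (hC : C.IsCircuit) : D.IsCircuit where
  order v := lt_eq v ▸ Refinement.strictOrder (hC.order v)
  comparable v k m hkm hd := by
    obtain ⟨y, hk, hm⟩ := Finset.not_disjoint_iff.1 hd
    rw [lt_eq]
    refine Refinement.comparable hkm fun hne => hC.comparable v _ _ hne ?_
    exact Finset.not_disjoint_iff.2
      ⟨y, mem_regs_proj k m y hne hk hm, mem_regs_proj m k y hne.symm hm hk⟩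

namespace Env

variable {P : Protocol} {I : IdealProtocol P} {E : Env P}

variable (I E) in
/-- The gate of the dummy adversary that forwards the registers of one kind to their copies, or
back. -/
noncomputable def forwardGate (a : E.Moved × Kind × Bool) : Gate :=
  ((E.slot I a.1.1).forwarding (E.gate a.1.1)).gate (P.status (E.moverRole a.1)).advGuard
    a.2.1 a.2.2

variable (I E) in
/-- The gates of the reduced environment: those of the environment, executed on the copies of the
forwarded registers, and those of the dummy adversary. -/
noncomputable def redGate : (E.App ⊕ E.Adv) ⊕ E.Moved × Kind × Bool → Gate :=
  Sum.elim (fun e => (E.gate e).rename (E.slot I e).ren) (E.forwardGate I)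

variable (E) in
/-- The gates of the reduced environment refine those of the environment. -/
noncomputable def redRefinement :
    Refinement (E.App ⊕ E.Adv) ((E.App ⊕ E.Adv) ⊕ E.Moved × Kind × Bool) :=
  wrap fun e => (E.mover e).isSome

open Classical in
variable (I E) in
/-- The reduced environment: all gates of the environment belong to the application and are executed
on fresh copies of the private registers and internal channel registers of the protocol; the dummy
adversary forwards these registers. If there is a circuit that is corrupted all the time, then the
internal channel registers are forwarded to the original application, too. -/
noncomputable def red : Env P where
  App := E.App ⊕ E.Adv
  Adv := E.Moved × Kind × Bool
  appFin := inferInstance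
  advFin := inferInstance
  gate := E.redGate I
  lt v := E.redRefinement.order (E.lt v)
  role a := E.moverRole a.1
  ord v := (E.redRefinement.sum P.body.Idx).order (E.ord v)
  own := (E.own ∪ Finset.univ.biUnion fun e => (E.gate e).regs).filter fun y => y ∉ P.regs
  Z := E.Z

theorem mem_own_red {y : Reg} : y ∈ (E.red I).own ↔ y ∈ E.regs := by
  simp only [red, Finset.mem_filter, Finset.mem_union, Finset.mem_biUnion, Finset.mem_univ,
    true_and]
  rfl

theorem size_red : (E.red I).size ≤ 7 * E.size := by
  have size_eq : (E.red I).size = E.size + Fintype.card (E.Moved × Kind × Bool) :=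
    Fintype.card_sum
  have card_le : Fintype.card (E.Moved × Kind × Bool) ≤ 6 * E.size := card_wrap_le
  omega

theorem Valid.initial_red (hE : E.Valid I) {v : Config} (hv : E.Initial v) :
    (E.red I).Initial v :=
  fun y hy => hv y fun ho => hy (mem_own_red.2 ⟨.inl ho, (hE.own_fresh y ho).1⟩)

section gates

variable {y : Reg}

theorem mem_internal_of_mem_targets_forwardGate {a : E.Moved × Kind × Bool}
    (h : y ∈ (E.forwardGate I a).op.targets) (hy : y ∈ P.regs) : y ∈ P.internal := by
  have hs := ((Slot.mem_supp_part _).1 (Slot.targets_op.subset h)).1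
  exact mem_internal_of_mem_dom ((mem_regs_iff_mem_dom hs).1 hy)

theorem guard_forwardGate (hP : P.WellFormed) (a : E.Moved × Kind × Bool) :
    (E.forwardGate I a).guard = (P.status (E.moverRole a.1)).advGuard := by
  refine Gate.guard_guarded fun q hq => ?_
  have hc := Protocol.mem_corr_of_mem_advGuard hq
  refine ⟨(hP.corr_bit _ hc).1, fun ht => (hP.corr_fresh _ hc).1 ?_⟩
  exact mem_internal_of_mem_targets_forwardGate (a := a) ht (.inr (.inr hc))

theorem mem_corr_or_mem_supp_of_mem_forwardGate (hP : P.WellFormed) {a : E.Moved × Kind × Bool}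
    (h : y ∈ (E.forwardGate I a).regs) : y ∈ P.corr ∨ y ∈ (E.slot I a.1.1).supp := by
  obtain ⟨b, hb⟩ | ht := Gate.mem_regs.1 h
  · rw [guard_forwardGate hP] at hb
    exact .inl (Protocol.mem_corr_of_mem_advGuard hb)
  · exact .inr ((Slot.mem_supp_part _).1 (Slot.targets_op.subset ht)).1

variable {i : (E.App ⊕ E.Adv) ⊕ E.Moved × Kind × Bool}

theorem mem_gate_or_mem_copies_of_mem_redGate (hP : P.WellFormed) (hE : E.Valid I)
    (h : y ∈ (E.redGate I i).regs) :
    y ∈ (E.gate (E.redRefinement.proj i)).regs ∨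
      y ∈ (E.slot I (E.redRefinement.proj i)).copies := by
  rcases i with e | a
  · have h : (E.slot I e).ren y ∈ (E.gate e).regs := Gate.mem_regs_rename.1 h
    by_cases hs : y ∈ (E.slot I e).supp
    · exact (Slot.mem_supp.1 hs).imp_left fun hd => dom_slot_subset hd
    · rw [Slot.ren_of_notMem_supp hs] at h
      exact .inl h
  · obtain ⟨b, hb⟩ | ht := Gate.mem_regs.1 h
    · rw [show (E.redGate I (.inr a)).guard = _ from guard_forwardGate hP a] at hb
      exact .inl (Gate.mem_regs_of_mem_guard (hE.advGuard_subset a.1 hb))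
    · have hs := ((Slot.mem_supp_part _).1 (Slot.targets_op.subset ht)).1
      exact (Slot.mem_supp.1 hs).imp_left fun hd => dom_slot_subset hd

theorem mem_gate_of_mem_redGate (hP : P.WellFormed) (hE : E.Valid I)
    (h : y ∈ (E.redGate I i).regs) (hy : y.name < E.bound I) :
    y ∈ (E.gate (E.redRefinement.proj i)).regs :=
  (mem_gate_or_mem_copies_of_mem_redGate hP hE h).resolve_right fun hc =>
    (bound_le_of_mem_copies hc).not_gt hy

theorem modifies_of_modifies_redGate (hy : y.name < E.bound I)
    (h : (E.redGate I i).Modifies y) : (E.gate (E.redRefinement.proj i)).Modifies y := by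
  rcases i with e | a
  · have h : (E.gate e).Modifies ((E.slot I e).ren y) := Gate.modifies_rename.1 h
    by_cases hs : y ∈ (E.slot I e).supp
    · rw [Slot.ren_of_mem_dom ((Slot.mem_supp_iff_of_lt hy).1 hs)] at h
      exact absurd (name_lt_of_mem_gate h.mem_regs)
        (Slot.bound_le_name_copy (σ := E.slot I e)).not_gt
    · rw [Slot.ren_of_notMem_supp hs] at h
      exact h
  · exact Slot.modifies_of_modifies_op dom_slot_subset hy h

theorem permits_redGate (hP : P.WellFormed) (hE : E.Valid I) (hy : y.name < E.bound I)
    (h : y ∈ (E.redGate I i).regs) {a : Access}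
    (ha : a.Permits (E.gate (E.redRefinement.proj i)) y) : a.Permits (E.redGate I i) y := by
  cases a with
  | no => exact absurd (mem_gate_of_mem_redGate hP hE h hy) ha
  | read => exact ⟨fun hm => ha.1 (modifies_of_modifies_redGate hy hm), ha.2⟩
  | full => trivial

theorem notMem_internal_of_mem_redGate (hP : P.WellFormed) (hE : E.Valid I) {e : E.App ⊕ E.Adv}
    (he : (E.mover e).isSome) (h : y ∈ (E.redGate I (.inl e)).regs) : y ∉ P.internal := by
  intro hi
  have hg := mem_gate_of_mem_redGate hP hE h (name_lt_of_mem_protocol (.inl hi))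
  have hren : (E.slot I e).ren y ∈ (E.gate e).regs := Gate.mem_regs_rename.1 h
  have hd : y ∈ (E.slot I e).dom := mem_dom_slot.2 ⟨hg, hi, he⟩
  rw [Slot.ren_of_mem_dom hd] at hren
  exact (name_lt_of_mem_gate hren).not_ge (Slot.bound_le_name_copy (σ := E.slot I e))

end gates

theorem Valid.appAccess_red (hE : E.Valid I) (hP : P.WellFormed) : (E.red I).AppAccess := by
  intro (e : E.App ⊕ E.Adv) y (hy : y ∈ (E.redGate I (.inl e)).regs)
  by_cases he : (E.mover e).isSome
  · have := notMem_internal_of_mem_redGate hP hE he hy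
    exact ⟨fun r hr => this (.inl ⟨r, hr⟩), fun hc => absurd (.inr hc) this⟩
  rcases e with a | a
  · have name_lt (h : y ∈ P.internal) : y.name < E.bound I := name_lt_of_mem_protocol (.inl h)
    have mem_gate (h : y ∈ P.internal) : y ∈ (E.gate (.inl a)).regs :=
      mem_gate_of_mem_redGate (i := .inl (.inl a)) hP hE hy (name_lt h)
    refine ⟨fun r hr => (hE.app a y (mem_gate (.inl ⟨r, hr⟩))).1 r hr, fun hc => ?_⟩
    exact permits_redGate (i := .inl (.inl a)) hP hE (name_lt (.inr hc)) hy
      ((hE.app a y (mem_gate (.inr hc))).2 hc)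
  · exact absurd rfl he

theorem Valid.advAccess_red (hE : E.Valid I) (hP : P.WellFormed) : (E.red I).AdvAccess := by
  intro (a : E.Moved × Kind × Bool)
  refine ⟨Status.advGate_iff.2 ⟨(Status.advGate_iff.1 (hE.advGate a.1)).1,
    (guard_forwardGate (I := I) hP a).ge⟩, fun y (hy : y ∈ (E.forwardGate I a).regs) => ?_⟩
  have mem_cases := mem_corr_or_mem_supp_of_mem_forwardGate hP hy
  have mem_gate (h : y ∈ P.regs) : y ∈ (E.gate a.1.1).regs :=
    mem_gate_of_mem_redGate (i := .inr a) hP hE hy (name_lt_of_mem_protocol h)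
  have permits (h : y ∈ P.regs) {b : Access} :
      b.Permits (E.gate a.1.1) y → b.Permits (E.forwardGate I a) y :=
    permits_redGate (i := .inr a) hP hE (name_lt_of_mem_protocol h) hy
  refine ⟨fun ho => ?_, fun r hr => ?_, fun hc => ?_, fun hc ht => ?_⟩
  · obtain ⟨hu, hn⟩ := mem_own_red.1 ho
    refine mem_cases.elim (fun h => hn (.inr (.inr h))) fun hs => hn ?_
    have hy : y.name < E.bound I := hu.elim name_lt_of_mem_own fun ⟨_, h⟩ => name_lt_of_mem_gate h
    exact .inl (mem_internal_of_mem_dom ((Slot.mem_supp_iff_of_lt hy).1 hs))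
  · have hy := mem_gate (.inl (.inl ⟨r, hr⟩))
    obtain ⟨⟨b | b, hb⟩, k⟩ := a
    · exact absurd hr ((hE.app b y hy).1 r)
    · exact ((hE.adv b).2 y hy).2.1 r hr
  · have hreg : y ∈ P.regs := Protocol.mem_regs_of_mem_channel hc
    have hy := mem_gate hreg
    obtain ⟨⟨b | b, hb⟩, k⟩ := a
    · obtain hc | hio := hc
      · exact .inr (permits hreg ((hE.app b y hy).2 hc))
      · refine absurd hio (mem_cases.elim (fun h => (hP.corr_fresh y h).2) fun hs => ?_)
        exact hP.notMem_io_of_mem_internal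
          (mem_internal_of_mem_dom ((mem_regs_iff_mem_dom hs).1 hreg))
    · exact (((hE.adv b).2 y hy).2.2.1 hc).imp (permits hreg) (permits hreg)
  · exact (hP.corr_fresh y hc).1
      (mem_internal_of_mem_targets_forwardGate ht (.inr (.inr hc)))

theorem Valid.isCircuit_red (hE : E.Valid I) (hP : P.WellFormed) :
    (E.red I).circuit.IsCircuit := by
  refine Refinement.isCircuit (C := E.circuit) E.redRefinement (fun _ => rfl) ?_ hE.isCircuit
  intro i j y hne hi hj
  refine (mem_gate_or_mem_copies_of_mem_redGate hP hE hi).resolve_right fun hci => hne ?_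
  refine eq_of_mem_copies hci ?_
  exact (mem_gate_or_mem_copies_of_mem_redGate hP hE hj).resolve_left fun h =>
    (bound_le_of_mem_copies hci).not_gt (name_lt_of_mem_gate h)

theorem Valid.isCircuit_real_red (hE : E.Valid I) (hP : P.WellFormed) :
    (E.red I).real.IsCircuit := by
  refine Refinement.isCircuit (C := E.real) (E.redRefinement.sum P.body.Idx) (fun _ => rfl) ?_
    hE.isCircuit_real
  intro i j y hne hi hj
  rcases i with i | p
  · refine (mem_gate_or_mem_copies_of_mem_redGate hP hE hi).resolve_right fun hci => hne ?_
    rcases j with j | q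
    · refine congrArg Sum.inl (eq_of_mem_copies hci ?_)
      exact (mem_gate_or_mem_copies_of_mem_redGate hP hE hj).resolve_left fun h =>
        (bound_le_of_mem_copies hci).not_gt (name_lt_of_mem_gate h)
    · exact absurd (name_lt_of_mem_protocol (hP.mem_regs_of_mem_body hj))
        (bound_le_of_mem_copies hci).not_gt
  · exact hi

theorem Valid.red (hE : E.Valid I) (hP : P.WellFormed) : (E.red I).Valid I where
  isCircuit := hE.isCircuit_red hP
  isCircuit_real := hE.isCircuit_real_red hP
  ord_env v i j h := h.imp (hE.ord_env v _ _) fun h => ⟨congrArg Sum.inl h.1, h.2⟩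
  ord_protocol v p q h := .inl (hE.ord_protocol v p q h)
  activated v p a hp j hj hm := by
    rcases j with j | q
    · have ha := Protocol.mem_regs_of_mem_channel (hP.act_mem_channel hp)
      exact .inl (hE.activated v p a hp _ Sum.inl_ne_inr
        (modifies_of_modifies_redGate (name_lt_of_mem_protocol ha) hm))
    · exact .inl (hE.activated v p a hp (.inr q)
        (fun h => hj (congrArg Sum.inr (Sum.inr_injective h))) hm)
  app := hE.appAccess_red hP
  adv := hE.advAccess_red hP
  own_fresh y hy := by
    obtain ⟨h, hn⟩ := mem_own_red.1 hy
    exact ⟨hn, h.elim (fun h => (hE.own_fresh y h).2) fun ⟨e, h⟩ => hE.ideal_fresh e y h⟩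
  ideal_fresh i y hy hI :=
    hE.ideal_fresh _ y (mem_gate_of_mem_redGate hP hE hy (name_lt_of_mem_ideal hI)) hI
  Z_own := mem_own_red.2 ⟨.inl hE.Z_own, (hE.own_fresh _ hE.Z_own).1⟩
  Z_bit := hE.Z_bit

theorem isDummy_red (hP : P.WellFormed) : (E.red I).IsDummy := fun a =>
  ⟨guard_forwardGate hP a, Slot.isForwarding_op (fun _ => mem_regs_iff_mem_dom) _ _⟩

theorem Valid.noDirectChannel_red (hE : E.Valid I) (hP : P.WellFormed) (h : P.HasEve) :
    (E.red I).NoDirectChannel := by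
  intro (e : E.App ⊕ E.Adv) y (hy : y ∈ (E.redGate I (.inl e)).regs) hc
  exact notMem_internal_of_mem_redGate hP hE (isSome_mover_of_hasEve h e) hy (.inr hc)

/-! ### The analysed side of the reduction -/

theorem kraus_redGate_of_not_isSome {e : E.App ⊕ E.Adv} (h : ¬ (E.mover e).isSome) (x : ℕ)
    (s : State) : (E.redGate I (.inl e)).kraus x s = (E.gate e).kraus x s :=
  Slot.kraus_rename_of_dom_eq_empty (dom_slot_of_not_isSome h) _ x s

theorem Valid.probZero_redGate (hE : E.Valid I) (hP : P.WellFormed) (Z : Reg)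
    (e : E.App ⊕ E.Adv) (m : List Gate) {s : State} (hs : s ∈ cleanStates (E.bound I)) :
    probZero Z ((E.redRefinement.block e).map (E.redGate I) ++ m) s =
      probZero Z (E.gate e :: m) s := by
  refine probZero_map_block_wrap (g := E.gate) (g' := fun e => E.redGate I (.inl e))
    (t := E.forwardGate I) (fun _ => Slot.numOut_gate) (Op.numOut_rename _ _)
    (fun h x => ?_) (fun h x => kraus_redGate_of_not_isSome h x s) Z m
  have notMem_dom : ∀ q ∈ (P.status (E.moverRole ⟨e, h⟩)).advGuard, q.1 ∉ (E.slot I e).dom :=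
    fun q hq hd => (hP.corr_fresh _ (Protocol.mem_corr_of_mem_advGuard hq)).1
      (mem_internal_of_mem_dom hd)
  exact Slot.run_forwarding (σ := E.slot I e) (hE.advGuard_subset ⟨e, h⟩) notMem_dom
    (fun y hy => name_lt_of_mem_gate hy) x hs

theorem Valid.prob_real_red (hE : E.Valid I) (hP : P.WellFormed) (Z : Reg) {v : Config}
    (hv : E.Initial v) (l : List E.real.Idx) :
    (E.red I).real.prob Z v (l.flatMap (E.redRefinement.sum P.body.Idx).block) =
      E.real.prob Z v l := by
  refine Refinement.prob_flatMap (V := cleanStates (E.bound I)) (C := E.real)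
    (D := (E.red I).real) (E.redRefinement.sum P.body.Idx) ?_ ?_ ?_ l
  · refine fun i x s => Gate.kraus_mem_cleanStates (fun y hy => ?_) x
    rcases i with e | p
    · exact name_lt_of_mem_gate hy
    · exact name_lt_of_mem_protocol (hP.mem_regs_of_mem_body hy)
  · intro i m s hs
    rcases i with e | p
    · exact (congrArg (fun l => probZero Z (l ++ m) s)
        (Refinement.map_block_sum_inl _ _ _ _)).trans (hE.probZero_redGate hP Z e m hs)
    · rfl
  · exact Finsupp.single_mem_supported ℂ 1 fun y hy =>
      hv y fun ho => (name_lt_of_mem_own ho).not_ge hy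

theorem Valid.close_of_close_red (hE : E.Valid I) (hP : P.WellFormed) {D : Circuit} {Z : Reg}
    {v : Config} {ε : ℝ} (hv : E.Initial v) (h : Close (E.red I).real D Z v ε) :
    Close E.real D Z v ε := by
  intro l m hl hm
  rw [← hE.prob_real_red hP Z hv l]
  refine h _ m (Circuit.isExecution_iff.2 ?_) hm
  exact Refinement.isListing_flatMap (hE.isCircuit_real.order v).1 (Circuit.isExecution_iff.1 hl)

end Env

/-! ### Simulators as parts of ideal adversaries -/

/-- A bijection between the gates of two circuits that preserves gates and partial orders. -/
structure Circuit.Iso (D C : Circuit) where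
  toEquiv : D.Idx ≃ C.Idx
  gate_eq : ∀ i, C.gate (toEquiv i) = D.gate i
  lt_iff : ∀ v i j, C.lt v (toEquiv i) (toEquiv j) ↔ D.lt v i j

namespace Circuit.Iso

variable {C D : Circuit} (φ : D.Iso C)
include φ

theorem isCircuit (hC : C.IsCircuit) : D.IsCircuit where
  order v := by
    refine ⟨fun i => ?_, fun i j k => ?_⟩ <;> simp only [← φ.lt_iff]
    · exact (hC.order v).1 _
    · exact (hC.order v).2 _ _ _
  comparable v i j hij h := by
    rw [← φ.lt_iff, ← φ.lt_iff]
    refine hC.comparable v _ _ (φ.toEquiv.injective.ne hij) ?_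
    rwa [φ.gate_eq, φ.gate_eq]

theorem isExecution_map {v : Config} {l : List D.Idx} (hl : D.IsExecution v l) :
    C.IsExecution v (l.map φ.toEquiv) where
  nodup := hl.nodup.map φ.toEquiv.injective
  all i := List.mem_map.2 ⟨φ.toEquiv.symm i, hl.all _, φ.toEquiv.apply_symm_apply i⟩
  compatible := List.pairwise_map.2 (hl.compatible.imp fun h => mt (φ.lt_iff _ _ _).1 h)

theorem prob_map (Z : Reg) (v : Config) (l : List D.Idx) :
    C.prob Z v (l.map φ.toEquiv) = D.prob Z v l := by
  rw [Circuit.prob, Circuit.prob, List.map_map]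
  exact congrArg (probZero Z · _) (List.map_congr_left fun i _ => φ.gate_eq i)

theorem close {B : Circuit} {Z : Reg} {v : Config} {ε : ℝ} (h : Close B C Z v ε) :
    Close B D Z v ε := by
  intro l m hl hm
  rw [← φ.prob_map]
  exact h l _ hl (φ.isExecution_map hm)

end Circuit.Iso

section

variable {P : Protocol} {I : IdealProtocol P} {E : Env P}

theorem Env.Valid.idealAccess (hE : E.Valid I) (a : E.Adv) :
    IdealAccess I (E.gate (.inr a)) := by
  obtain ⟨advGate, access⟩ := hE.adv a
  refine ⟨fun y ht hc => (access y (Gate.mem_regs_of_mem_targets ht)).2.2.2 hc ht,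
    .inr ⟨E.role a, advGate, fun y hy => ⟨fun hio => (access y hy).2.2.1 (.inr hio), ?_⟩⟩⟩
  exact fun hI => absurd hI (hE.ideal_fresh _ y hy)

namespace Simulator

variable (S : Simulator I E)

/-- The adversary together with the simulator, as an ideal adversary. -/
def toIdealAdv : IdealAdv I E where
  Idx := E.Adv ⊕ S.Idx
  fin := inferInstance
  gate := Sum.elim (fun a => E.gate (.inr a)) S.gate
  ord v i j := S.ord v (Sum.map (Equiv.sumAssoc _ _ _).symm id i)
    (Sum.map (Equiv.sumAssoc _ _ _).symm id j)

/-- Both ideal sides consist of the same gates. -/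
def idealIso : S.toIdealAdv.ideal.Iso S.ideal where
  toEquiv := (Equiv.sumAssoc E.App E.Adv S.Idx).symm.sumCongr (Equiv.refl I.body.Idx)
  gate_eq i := by rcases i with (i | i | i) | i <;> rfl
  lt_iff _ _ _ := Iff.rfl

theorem size_toIdealAdv : S.toIdealAdv.size ≤ E.size + S.size := by
  have size_eq : S.toIdealAdv.size = Fintype.card E.Adv + S.size := Fintype.card_sum
  have env_size_eq : E.size = Fintype.card E.App + Fintype.card E.Adv := Fintype.card_sum
  omega

variable {S}

theorem Valid.toIdealAdv (hE : E.Valid I) (hS : S.Valid) : S.toIdealAdv.Valid where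
  isCircuit := S.idealIso.isCircuit hS.isCircuit
  ord_app v _ _ h := hS.ord_env v _ _ h
  ord_protocol v p q h := hS.ord_protocol v p q h
  activated v p a hp j hj hm := by
    refine hS.activated v p a hp (S.idealIso.toEquiv j) (fun e => hj ?_) ?_
    · exact S.idealIso.toEquiv.injective e
    · rwa [S.idealIso.gate_eq]
  access i := by
    rcases i with a | s
    · exact hE.idealAccess a
    · exact hS.access s
  own_fresh i y hy ho := by
    rcases i with a | s
    · exact ((hE.adv a).2 y hy).1 ho
    · exact hS.env_fresh s y hy ⟨.inl ho, (hE.own_fresh y ho).1⟩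

end Simulator

end

/-! ### The simulator from an ideal adversary against the reduced environment -/

theorem Slot.mem_supp_of_mem_gate {σ : Slot} {g : Gate} {p : σ.Transport g} {k : Kind}
    {back : Bool} {y : Reg} (h : y ∈ (p.gate ∅ k back).regs) : y ∈ σ.supp := by
  obtain ⟨b, hb⟩ | ht := Gate.mem_regs.1 h
  · exact absurd (Finset.mem_filter.1 hb).1 (Finset.notMem_empty _)
  · exact ((Slot.mem_supp_part _).1 (Slot.targets_op.subset ht)).1

section

variable {P : Protocol} {I : IdealProtocol P} {E : Env P}

section slot

variable {e : E.App ⊕ E.Adv} {y : Reg}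

theorem Env.notMem_of_mem_copies (hy : y ∈ (E.slot I e).copies) :
    y ∉ P.regs ∧ y ∉ I.internal ∧ y ∉ E.regs := by
  have not_lt := (bound_le_of_mem_copies hy).not_gt
  refine ⟨fun h => not_lt (name_lt_of_mem_protocol h), fun h => not_lt (name_lt_of_mem_ideal h), ?_⟩
  exact fun h => not_lt (h.1.elim name_lt_of_mem_own fun ⟨_, h⟩ => name_lt_of_mem_gate h)

theorem WellFormedPair.notMem_of_mem_supp (h : WellFormedPair P I) (hy : y ∈ (E.slot I e).supp) :
    y ∉ P.io ∧ y ∉ P.corr ∧ y ∉ I.internal ∧ y ∉ E.regs := by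
  obtain ⟨hP, hI⟩ := h
  obtain hd | hc := Slot.mem_supp.1 hy
  · have hi := Env.mem_internal_of_mem_dom hd
    exact ⟨hP.notMem_io_of_mem_internal hi, fun hc => (hP.corr_fresh y hc).1 hi,
      fun h => hI.internal_fresh y h (.inl hi), fun h => h.2 (.inl hi)⟩
  · obtain ⟨h, hI', hE⟩ := Env.notMem_of_mem_copies hc
    exact ⟨fun hio => h (.inr (.inl hio)), fun hcorr => h (.inr (.inr hcorr)), hI', hE⟩

end slot

namespace IdealAdv

variable (I E) in
/-- The gates of the simulator that exchange registers of the protocol with their copies. -/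
noncomputable def exchangeGate (a : E.Moved × Kind × Bool) : Gate :=
  ((E.slot I a.1.1).swapping (E.gate a.1.1)).gate ∅ a.2.1 a.2.2

theorem mem_supp_of_mem_exchangeGate {a : E.Moved × Kind × Bool} {y : Reg}
    (h : y ∈ (exchangeGate I E a).regs) : y ∈ (E.slot I a.1.1).supp :=
  Slot.mem_supp_of_mem_gate h

variable (A : IdealAdv I (E.red I))

/-- The gates on the ideal side with the simulator refine those on the ideal side with the ideal
adversary. -/
noncomputable def simRefinement : Refinement A.ideal.Idx
    (((E.App ⊕ E.Adv) ⊕ (E.Moved × Kind × Bool) ⊕ A.Idx) ⊕ I.body.Idx) :=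
  ((E.redRefinement.sum A.Idx).sum I.body.Idx).comap
    ((Equiv.sumAssoc _ _ _).symm.sumCongr (Equiv.refl _))

variable {A}

namespace Valid

variable (hA : A.Valid)

/-- An execution of the ideal side. -/
noncomputable def listing (v : Config) : List A.ideal.Idx :=
  (hA.isCircuit.order v).exists_isListing.choose

theorem isListing_listing (v : Config) : IsListing (A.ideal.lt v) (hA.listing v) :=
  (hA.isCircuit.order v).exists_isListing.choose_spec

open Classical in
/-- The total order of the gates in the execution `listing`. -/
def Precedes (v : Config) (i j : A.ideal.Idx) : Prop :=
  (hA.listing v).idxOf i < (hA.listing v).idxOf j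

theorem strictOrder_precedes (v : Config) : StrictOrder (hA.Precedes v) :=
  ⟨fun _ => lt_irrefl _, fun _ _ _ => lt_trans⟩

theorem isListing_precedes (v : Config) : IsListing (hA.Precedes v) (hA.listing v) := by
  classical
  exact (hA.isListing_listing v).idxOf

variable {hA} in
theorem precedes_of_lt {v : Config} {i j : A.ideal.Idx} (h : A.ideal.lt v i j) :
    hA.Precedes v i j := by
  classical
  exact (hA.isListing_listing v).idxOf_lt_of_rel (hA.isCircuit.order v) h

variable {hA} in
theorem precedes_or_precedes (v : Config) {i j : A.ideal.Idx} (hij : i ≠ j) :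
    hA.Precedes v i j ∨ hA.Precedes v j i := by
  classical
  exact (hA.isListing_listing v).idxOf_lt_or_gt hij

/-- The simulator that runs the ideal adversary and, before and after each gate of the environment,
exchanges registers of the protocol with the copies on which the reduced environment operates. The
ideal side is ordered totally, along one execution with the ideal adversary. -/
noncomputable def toSimulator : Simulator I E where
  Idx := (E.Moved × Kind × Bool) ⊕ A.Idx
  fin := inferInstance
  gate := Sum.elim (exchangeGate I E) A.gate
  ord v := A.simRefinement.order (hA.Precedes v)

theorem size_toSimulator : hA.toSimulator.size ≤ A.size + 6 * E.size := by
  have size_eq : hA.toSimulator.size = Fintype.card (E.Moved × Kind × Bool) + A.size :=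
    Fintype.card_sum
  have card_le : Fintype.card (E.Moved × Kind × Bool) ≤ 6 * E.size := card_wrap_le
  omega

variable {hA}

theorem ord_toSimulator {v : Config} {i j : hA.toSimulator.ideal.Idx}
    (h : A.ord v (A.simRefinement.proj i) (A.simRefinement.proj j)) :
    hA.toSimulator.ord v i j :=
  .inl (precedes_of_lt h)

theorem ord_toSimulator_total {v : Config} (i j : hA.toSimulator.ideal.Idx) (hij : i ≠ j) :
    hA.toSimulator.ord v i j ∨ hA.toSimulator.ord v j i :=
  Refinement.comparable (R := A.simRefinement) hij (precedes_or_precedes v)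

theorem isCircuit_toSimulator : hA.toSimulator.ideal.IsCircuit where
  order v := Refinement.strictOrder (hA.strictOrder_precedes v)
  comparable _ i j hij _ := ord_toSimulator_total i j hij

theorem modifies_toSimulator {a : Reg} (ha : ∀ e, a ∉ (E.slot I e).supp)
    {j : hA.toSimulator.ideal.Idx} (hm : (hA.toSimulator.ideal.gate j).Modifies a) :
    (A.ideal.gate (A.simRefinement.proj j)).Modifies a := by
  rcases j with (e | s | s) | q
  · have hm : (E.gate e).Modifies a := hm
    rw [← Slot.ren_of_notMem_supp (ha e)] at hm
    exact Gate.modifies_rename.2 hm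
  · exact absurd (mem_supp_of_mem_exchangeGate hm.mem_regs) (ha _)
  · exact hm
  · exact hm

theorem activated_toSimulator (h : WellFormedPair P I) :
    Activated I.toProtocol hA.toSimulator.ideal Sum.inr := by
  intro v p a hp j hj hm
  have notMem_supp (e : E.App ⊕ E.Adv) : a ∉ (E.slot I e).supp := fun ha => by
    obtain ⟨hio, -, hI, -⟩ := h.notMem_of_mem_supp ha
    exact (h.2.protocol.act_mem_channel hp).elim (fun h => hI (.inr h)) fun hc =>
      hio (h.2.io_subset hc)
  refine ord_toSimulator (hA.activated v p a hp _ ?_ (modifies_toSimulator notMem_supp hm))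
  rcases j with (e | s | s) | q
  · exact Sum.inl_ne_inr
  · exact Sum.inl_ne_inr
  · exact Sum.inl_ne_inr
  · exact fun h => hj (congrArg Sum.inr (Sum.inr_injective h))

theorem toSimulator_valid (h : WellFormedPair P I) : hA.toSimulator.Valid where
  isCircuit := isCircuit_toSimulator
  ord_env v e f hef := ord_toSimulator (hA.ord_app v e f (.inl hef))
  ord_protocol v p q hpq := ord_toSimulator (hA.ord_protocol v p q hpq)
  activated := activated_toSimulator h
  access s := by
    rcases s with s | s
    · have notMem (y) (hy : y ∈ (exchangeGate I E s).regs) :=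
        h.notMem_of_mem_supp (mem_supp_of_mem_exchangeGate hy)
      exact ⟨fun y hy => (notMem y (Gate.mem_regs_of_mem_targets hy)).2.1,
        .inl fun y hy => ⟨(notMem y hy).1, (notMem y hy).2.2.1⟩⟩
    · exact hA.access s
  env_fresh s y hy := by
    rcases s with s | s
    · exact (h.notMem_of_mem_supp (mem_supp_of_mem_exchangeGate hy)).2.2.2
    · exact fun h => hA.own_fresh s y hy (Env.mem_own_red.2 h)

theorem probZero_exchange (Z : Reg) (e : E.App ⊕ E.Adv) (m : List Gate) (s : State) :
    probZero Z ((E.redRefinement.block e).map (Sum.elim E.gate (exchangeGate I E)) ++ m) s =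
      probZero Z (E.redGate I (.inl e) :: m) s := by
  refine probZero_map_block_wrap (g := fun e => E.redGate I (.inl e)) (g' := E.gate)
    (t := exchangeGate I E) (fun _ => Slot.numOut_gate) (Op.numOut_rename _ _).symm
    (fun _ x => ?_) (fun h x => (Env.kraus_redGate_of_not_isSome h x s).symm) Z m
  exact Slot.run_swapping (σ := E.slot I e) (g := E.gate e) x s

theorem map_gate_block (e : E.App ⊕ E.Adv) :
    (A.simRefinement.block (.inl (.inl e))).map hA.toSimulator.ideal.gate =
      (E.redRefinement.block e).map (Sum.elim E.gate (exchangeGate I E)) := by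
  change ((((E.redRefinement.block e).map Sum.inl).map Sum.inl).map
    ((Equiv.sumAssoc _ _ _).symm.sumCongr (Equiv.refl _)).symm).map _ = _
  rw [List.map_map, List.map_map]
  exact List.map_map.trans (List.map_congr_left fun k _ => by rcases k with e | a <;> rfl)

theorem prob_toSimulator (Z : Reg) (v : Config) (l : List A.ideal.Idx) :
    hA.toSimulator.ideal.prob Z v (l.flatMap A.simRefinement.block) = A.ideal.prob Z v l := by
  refine Refinement.prob_flatMap (V := ⊤) (C := A.ideal) (D := hA.toSimulator.ideal)
    A.simRefinement (fun _ _ _ _ => trivial) (fun i m s _ => ?_) trivial l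
  rcases i with (e | a) | q
  · exact (congrArg (fun l => probZero Z (l ++ m) s) (map_gate_block e)).trans
      (probZero_exchange Z e m s)
  · rfl
  · rfl

theorem close_toSimulator {C : Circuit} {Z : Reg} {v : Config} {ε : ℝ}
    (h : Close C A.ideal Z v ε) : Close C hA.toSimulator.ideal Z v ε := by
  intro l m hl hm
  have m_eq : m = (hA.listing v).flatMap A.simRefinement.block :=
    IsListing.eq_of_total ord_toSimulator_total (Circuit.isExecution_iff.1 hm)
      (Refinement.isListing_flatMap (hA.strictOrder_precedes v).1 (hA.isListing_precedes v))
  have prob_eq : hA.toSimulator.ideal.prob Z v m = A.ideal.prob Z v (hA.listing v) :=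
    (congrArg _ m_eq).trans (prob_toSimulator Z v _)
  rw [prob_eq]
  exact h l _ hl (Circuit.isExecution_iff.2 (hA.isListing_listing v))

end Valid

end IdealAdv

end

/-! ### Security -/

section

variable {P : Protocol} {I : IdealProtocol P} {E : Env P}

theorem exists_idealAdv (hE : E.Valid I) {ε : ℝ} {S : Simulator I E} (hS : S.Valid)
    (h : ∀ v, E.Initial v → Close E.real S.ideal E.Z v ε) :
    ∃ A : IdealAdv I E, A.Valid ∧ A.size ≤ E.size + S.size ∧
      ∀ v, E.Initial v → Close E.real A.ideal E.Z v ε :=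
  ⟨S.toIdealAdv, hS.toIdealAdv hE, S.size_toIdealAdv, fun v hv => S.idealIso.close (h v hv)⟩

theorem exists_simulator_of_red (hPI : WellFormedPair P I) (hE : E.Valid I) {ε : ℝ}
    {A : IdealAdv I (E.red I)} (hA : A.Valid)
    (h : ∀ v, (E.red I).Initial v → Close (E.red I).real A.ideal (E.red I).Z v ε) :
    ∃ S : Simulator I E, S.Valid ∧ S.size ≤ A.size + 6 * E.size ∧
      ∀ v, E.Initial v → Close E.real S.ideal E.Z v ε :=
  ⟨hA.toSimulator, IdealAdv.Valid.toSimulator_valid hPI, hA.size_toSimulator, fun v hv =>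
    hE.close_of_close_red hPI.1 hv (IdealAdv.Valid.close_toSimulator (h v (hE.initial_red hv)))⟩

theorem Realizes.mono {K K' : Env P → Prop} {ε : Env P → ℝ} (h : Realizes I K ε)
    (hK : ∀ E, K' E → K E) : Realizes I K' ε :=
  fun E hE hE' => h E hE (hK E hE')

theorem Realizes.altRealizes {K : Env P → Prop} {ε : Env P → ℝ} (h : Realizes I K ε) :
    AltRealizes I K ε := by
  intro E hE hK
  obtain ⟨S, hS, hclose⟩ := h E hE hK
  obtain ⟨A, hA, -, hclose'⟩ := exists_idealAdv hE hS hclose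
  exact ⟨A, hA, hclose'⟩

theorem AltRealizes.realizes (hPI : WellFormedPair P I) {K : Env P → Prop} {ε : Env P → ℝ}
    (h : AltRealizes I K ε) (hK : ∀ E : Env P, E.Valid I → K (E.red I)) :
    Realizes I allEnv fun E => ε (E.red I) := by
  intro E hE _
  obtain ⟨A, hA, hclose⟩ := h _ (hE.red hPI.1) (hK E hE)
  obtain ⟨S, hS, -, hclose'⟩ := exists_simulator_of_red hPI hE hA hclose
  exact ⟨S, hS, hclose'⟩

theorem Realizes.of_dummyEnv (hPI : WellFormedPair P I) {ε : Env P → ℝ}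
    (h : Realizes I dummyEnv ε) : Realizes I allEnv fun E => ε (E.red I) :=
  h.altRealizes.realizes hPI fun _ _ => Env.isDummy_red hPI.1

theorem Realizes.of_noChannelEnv (hPI : WellFormedPair P I) (hEve : P.HasEve) {ε : Env P → ℝ}
    (h : Realizes I noChannelEnv ε) : Realizes I allEnv fun E => ε (E.red I) :=
  h.altRealizes.realizes hPI fun _ hE => hE.noDirectChannel_red hPI.1 hEve

theorem realizes_tfae (hPI : WellFormedPair P I) (ε : ℝ) :
    [Realizes I allEnv (fun _ => ε), Realizes I dummyEnv (fun _ => ε),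
      AltRealizes I allEnv (fun _ => ε)].TFAE := by
  tfae_have 1 → 2 := fun h => h.mono fun _ _ => trivial
  tfae_have 2 → 1 := Realizes.of_dummyEnv hPI
  tfae_have 1 → 3 := Realizes.altRealizes
  tfae_have 3 → 1 := fun h => h.realizes hPI fun _ _ => trivial
  tfae_finish

theorem realizes_noChannelEnv_iff (hPI : WellFormedPair P I) (hEve : P.HasEve) (ε : ℝ) :
    Realizes I noChannelEnv (fun _ => ε) ↔ Realizes I allEnv (fun _ => ε) :=
  ⟨Realizes.of_noChannelEnv hPI hEve, fun h => h.mono fun _ _ => trivial⟩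

end

/-! ### Computational security -/

theorem PolyBounded.add {f g : ℕ → ℕ} (hf : PolyBounded f) (hg : PolyBounded g) :
    PolyBounded fun n => f n + g n := by
  obtain ⟨p, hp⟩ := hf
  obtain ⟨q, hq⟩ := hg
  exact ⟨p + q, fun n => (add_le_add (hp n) (hq n)).trans_eq Polynomial.eval_add.symm⟩

theorem PolyBounded.const_mul {f : ℕ → ℕ} (hf : PolyBounded f) (k : ℕ) :
    PolyBounded fun n => k * f n := by
  obtain ⟨p, hp⟩ := hf
  exact ⟨Polynomial.C k * p, fun n =>
    (Nat.mul_le_mul_left k (hp n)).trans_eq Polynomial.eval_C_mul.symm⟩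

theorem PolyBounded.of_le {f g : ℕ → ℕ} (hg : PolyBounded g) (h : ∀ n, f n ≤ g n) :
    PolyBounded f := by
  obtain ⟨p, hp⟩ := hg
  exact ⟨p, fun n => (h n).trans (hp n)⟩

/-- The largest error bound for environments that are up to `κ` times as large. -/
noncomputable def scaledError (κ : ℕ) (ε : ℕ → ℕ → ℝ) (n s : ℕ) : ℝ :=
  (Finset.range (κ * s + 1)).sup' Finset.nonempty_range_add_one (ε n)

theorem le_scaledError {κ : ℕ} {ε : ℕ → ℕ → ℝ} {n s t : ℕ} (h : t ≤ κ * s) :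
    ε n t ≤ scaledError κ ε n s :=
  Finset.le_sup' (ε n) (Finset.mem_range_succ_iff.2 h)

theorem exists_scaledError_eq (κ : ℕ) (ε : ℕ → ℕ → ℝ) (n s : ℕ) :
    ∃ t ≤ κ * s, scaledError κ ε n s = ε n t := by
  obtain ⟨t, ht, h⟩ := Finset.exists_mem_eq_sup' Finset.nonempty_range_add_one (ε n)
  exact ⟨t, Finset.mem_range_succ_iff.1 ht, h⟩

theorem Negligible.scaledError {ε : ℕ → ℕ → ℝ} (h : Negligible ε) (κ : ℕ) :
    Negligible (scaledError κ ε) := by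
  intro f hf q hq
  choose t ht hmax using fun n => exists_scaledError_eq κ ε n (f n)
  filter_upwards [h t ((hf.const_mul κ).of_le ht) q hq] with n hn
  exact (hmax n).trans_le hn

section

variable {P : ℕ → Protocol} {I : (n : ℕ) → IdealProtocol (P n)}

theorem CompRealizes.mono {K K' : (n : ℕ) → Env (P n) → Prop} (h : CompRealizes I K)
    (hK : ∀ n E, K' n E → K n E) : CompRealizes I K' := by
  obtain ⟨hP, hI, ε, hε, h⟩ := h
  exact ⟨hP, hI, ε, hε, fun E hE hE' => h E hE fun n => hK n _ (hE' n)⟩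

theorem CompRealizes.altCompRealizes {K : (n : ℕ) → Env (P n) → Prop} (h : CompRealizes I K) :
    AltCompRealizes I K := by
  obtain ⟨hP, hI, ε, hε, h⟩ := h
  refine ⟨hP, hI, ε, hε, fun E hE hK hpoly => ?_⟩
  obtain ⟨S, hS, hSpoly, hclose⟩ := h E hE hK hpoly
  choose A hA hsize hclose' using fun n => exists_idealAdv (hE n) (hS n) (hclose n)
  exact ⟨A, hA, (hpoly.add hSpoly).of_le hsize, hclose'⟩

theorem AltCompRealizes.compRealizes (hPI : ∀ n, WellFormedPair (P n) (I n))
    {K : (n : ℕ) → Env (P n) → Prop} (h : AltCompRealizes I K)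
    (hK : ∀ n (E : Env (P n)), E.Valid (I n) → K n (E.red (I n))) :
    CompRealizes I fun _ => allEnv := by
  obtain ⟨hP, hI, ε, hε, h⟩ := h
  refine ⟨hP, hI, scaledError 7 ε, hε.scaledError 7, fun E hE _ hpoly => ?_⟩
  obtain ⟨A, hA, hApoly, hclose⟩ := h (fun n => (E n).red (I n)) (fun n => (hE n).red (hPI n).1)
    (fun n => hK n _ (hE n)) ((hpoly.const_mul 7).of_le fun n => Env.size_red)
  choose S hS hsize hclose' using fun n => exists_simulator_of_red (hPI n) (hE n) (hA n) (hclose n)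
  refine ⟨S, hS, (hApoly.add (hpoly.const_mul 6)).of_le hsize, fun n v hv l m hl hm => ?_⟩
  exact (hclose' n v hv l m hl hm).trans (le_scaledError Env.size_red)

theorem compRealizes_tfae (hPI : ∀ n, WellFormedPair (P n) (I n)) :
    [CompRealizes I (fun _ => allEnv), CompRealizes I (fun _ => dummyEnv),
      AltCompRealizes I (fun _ => allEnv)].TFAE := by
  tfae_have 1 → 2 := fun h => h.mono fun _ _ _ => trivial
  tfae_have 2 → 1 := fun h =>
    h.altCompRealizes.compRealizes hPI fun n _ _ => Env.isDummy_red (hPI n).1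
  tfae_have 1 → 3 := CompRealizes.altCompRealizes
  tfae_have 3 → 1 := fun h => h.compRealizes hPI fun _ _ _ => trivial
  tfae_finish

theorem compRealizes_noChannelEnv_iff (hPI : ∀ n, WellFormedPair (P n) (I n))
    (hEve : ∀ n, (P n).HasEve) :
    CompRealizes I (fun _ => noChannelEnv) ↔ CompRealizes I (fun _ => allEnv) :=
  ⟨fun h => h.altCompRealizes.compRealizes hPI fun n _ hE =>
    hE.noDirectChannel_red (hPI n).1 (hEve n), fun h => h.mono fun _ _ _ => trivial⟩

end

end QUC

theorem mainTheorem3 :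
    -- error bound that may depend on the environment, with a reduction to a dummy adversary
    (∃ κ : ℕ, ∀ (P : QUC.Protocol) (I : QUC.IdealProtocol P), QUC.WellFormedPair P I →
      (∀ ε : QUC.Env P → ℝ, QUC.Realizes I QUC.allEnv ε → QUC.AltRealizes I QUC.allEnv ε) ∧
      ∃ red : QUC.Env P → QUC.Env P,
        (∀ E : QUC.Env P, E.Valid I →
          (red E).Valid I ∧ (red E).IsDummy ∧ (red E).size ≤ κ * E.size ∧
            (P.HasEve → (red E).NoDirectChannel)) ∧
        ∀ ε : QUC.Env P → ℝ,
          (QUC.AltRealizes I QUC.allEnv ε → QUC.Realizes I QUC.allEnv (fun E => ε (red E))) ∧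
          (QUC.Realizes I QUC.dummyEnv ε → QUC.Realizes I QUC.allEnv (fun E => ε (red E))) ∧
          (P.HasEve → QUC.Realizes I QUC.noChannelEnv ε →
            QUC.Realizes I QUC.allEnv (fun E => ε (red E)))) ∧
    -- unconditional scenario: error bound that does not depend on the environment
    (∀ (P : QUC.Protocol) (I : QUC.IdealProtocol P), QUC.WellFormedPair P I → ∀ ε : ℝ,
      [QUC.Realizes I QUC.allEnv (fun _ => ε), QUC.Realizes I QUC.dummyEnv (fun _ => ε),
        QUC.AltRealizes I QUC.allEnv (fun _ => ε)].TFAE ∧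
      (P.HasEve →
        (QUC.Realizes I QUC.noChannelEnv (fun _ => ε) ↔ QUC.Realizes I QUC.allEnv (fun _ => ε)))) ∧
    -- computational scenario
    (∀ (P : ℕ → QUC.Protocol) (I : (n : ℕ) → QUC.IdealProtocol (P n)),
      (∀ n, QUC.WellFormedPair (P n) (I n)) →
      [QUC.CompRealizes I (fun _ => QUC.allEnv), QUC.CompRealizes I (fun _ => QUC.dummyEnv),
        QUC.AltCompRealizes I (fun _ => QUC.allEnv)].TFAE ∧
      ((∀ n, (P n).HasEve) →
        (QUC.CompRealizes I (fun _ => QUC.noChannelEnv) ↔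
          QUC.CompRealizes I (fun _ => QUC.allEnv)))) := by
  refine ⟨⟨7, fun P I hPI => ⟨fun ε => QUC.Realizes.altRealizes, fun E => E.red I, fun E hE => ?_,
    fun ε => ⟨?_, ?_, fun hEve => ?_⟩⟩⟩, fun P I hPI ε => ⟨?_, fun hEve => ?_⟩,
    fun P I hPI => ⟨?_, fun hEve => ?_⟩⟩
  · exact ⟨hE.red hPI.1, QUC.Env.isDummy_red hPI.1, QUC.Env.size_red,
      hE.noDirectChannel_red hPI.1⟩
  · exact fun h => h.realizes hPI fun _ _ => trivial
  · exact QUC.Realizes.of_dummyEnv hPI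
  · exact QUC.Realizes.of_noChannelEnv hPI hEve
  · exact QUC.realizes_tfae hPI ε
  · exact QUC.realizes_noChannelEnv_iff hPI hEve ε
  · exact QUC.compRealizes_tfae hPI
  · exact QUC.compRealizes_noChannelEnv_iff hPI hEve
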